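/- Let $\mathcal X$ and $\mathcal Y$ be discrete alphabets, let $W(\cdot\mid x)$, $x\in\mathcal X$, be probability distributions on $\mathcal Y$, and let $c:\mathcal X\to[0,\infty)$ be a cost function for which there is a free symbol $0\in\mathcal X$, $c(0)=0$. The memoryless channel $\mathrm{DMC}(W)$ maps an input sequence to a sequence of the same length whose entries are independent, the entry belonging to an input symbol $x$ having law $W(\cdot\mid x)$. An insertion/deletion channel $\mathrm{IDC}(\mu,\sigma^2)$ maps $(x[1],\dots,x[T])$ to the sequence in which each $x[t]$ is repeated $s[t]$ times, in order, where the states $s[1],\dots,s[T]\in\{0,1,2,\dots\}$ are i.i.d. with an arbitrary law of finite mean $\mu$ and finite variance $\sigma^2$. For a channel with input alphabet $\mathcal X$, a $(T,M,P,\varepsilon)$ code consists of $M$ codewords in $\mathcal X^T$, each of total cost $\sum_{t=1}^T c(x[t])\le P$, and a decoder that observes the whole output sequence (and so its length), with average probability of decoding error at most $\varepsilon$ for equiprobable messages. A rate $\hat R\ge 0$ per unit cost is achievable if for every $\varepsilon>0$ and every large enough $M$ there is a $(T,M,P,\varepsilon)$ code with $\log_2(M)/P\ge\hat R$ (where $P=0$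 counts as an infinite rate per unit cost). The capacity per unit cost, an element of $[0,\infty]$, is the supremum of the achievable rates per unit cost (and $0$ if there is none). Let $\hat C(W)$ be the capacity per unit cost of $\mathrm{DMC}(W)$, and let $\hat C(\mu,\sigma^2,W)$ be that of the channel formed by an $\mathrm{IDC}(\mu,\sigma^2)$ whose output is fed into $\mathrm{DMC}(W)$, with the same cost function. Then, with the convention $0\cdot\infty=0$, $$\frac{\mu}{2}\,\hat C(W)\;\le\;\hat C(\mu,\sigma^2,W)\;\le\;\mu\,\hat C(W).$$ -/

import Mathlib

open scoped NNReal ENNReal ProbabilityTheory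

namespace InsDel

noncomputable section

/-- The joint law of independent random variables with laws `p₁, …, pₙ`, as a law on sequences of
length `n`. -/
def indep {α : Type*} : List (PMF α) → PMF (List α)
  | [] => PMF.pure []
  | p :: ps => p.bind fun a => (indep ps).map fun as => a :: as

/-- A channel with input alphabet `X` and output alphabet `Y`: the law of the (possibly
random-length) output sequence, for each finite input sequence. -/
abbrev Channel (X Y : Type*) := List X → PMF (List Y)

/-- The discrete memoryless channel with transition probabilities `W (· | x)`: the outputs are
independent, and the output belonging to the input symbol `x` has law `W x`. -/
def dmc {X Y : Type*} (W : X → PMF Y) : Channel X Y := fun x => indep (x.map W)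

/-- The output of the insertion/deletion channel for the state sequence `s`: the symbol `x[t]` is
repeated `s[t]` times, in the order of `t`. -/
def repeatSymbols {X : Type*} (s : List ℕ) (x : List X) : List X :=
  (List.zipWith List.replicate s x).flatten

/-- The insertion/deletion channel whose states are i.i.d. with law `S`. -/
def idc {X : Type*} (S : PMF ℕ) : Channel X X := fun x =>
  (indep (List.replicate x.length S)).map fun s => repeatSymbols s x

/-- The concatenation of two channels: the output of the first is the input of the second. -/
def Channel.concat {X Y Z : Type*} (K : Channel X Y) (K' : Channel Y Z) : Channel X Z :=
  fun x => (K x).bind K'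

/-- The law `S` of the state `s[1]` has finite mean `μ` and finite variance `σsq`. -/
def HasMeanVariance (S : PMF ℕ) (μ σsq : ℝ) : Prop :=
  MeasureTheory.MemLp (fun k : ℕ => (k : ℝ)) 2 S.toMeasure ∧
    ∫ k : ℕ, (k : ℝ) ∂S.toMeasure = μ ∧
    ProbabilityTheory.variance (fun k : ℕ => (k : ℝ)) S.toMeasure = σsq

/-- `M` codewords of length `T`, and a decoder for the output sequences of every length. The
decoder may also declare an error (`none`). -/
structure Code (X Y : Type*) (T M : ℕ) where
  word : Fin M → List X
  length_word : ∀ m, (word m).length = T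
  decode : List Y → Option (Fin M)

/-- The probability of decoding error over the channel `K`, averaged over equiprobable messages. -/
def Code.errorProb {X Y : Type*} {T M : ℕ} (C : Code X Y T M) (K : Channel X Y) : ℝ≥0∞ :=
  (∑ m : Fin M, (K (C.word m)).toOuterMeasure {y | C.decode y ≠ some m}) / M

/-- The cost of a sequence is the sum of the costs of its symbols. -/
def seqCost {X : Type*} (c : X → ℝ≥0) (x : List X) : ℝ≥0 := (x.map c).sum

/-- There is a `(T, M, P, ε)` code for the channel `K` with the cost function `c`. -/
def ExistsCode {X Y : Type*} (c : X → ℝ≥0) (K : Channel X Y) (T M : ℕ) (P : ℝ≥0) (ε : ℝ) : Prop :=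
  ∃ C : Code X Y T M, (∀ m, seqCost c (C.word m) ≤ P) ∧ C.errorProb K ≤ ENNReal.ofReal ε

/-- The rate `R` per unit cost is achievable: for every `ε > 0` and every large enough `M` there is
a `(T, M, P, ε)` code with `log₂ M / P ≥ R`. The inequality is written as `R * P ≤ log₂ M`, so that
`P = 0` counts as an infinite rate per unit cost. -/
def Achievable {X Y : Type*} (c : X → ℝ≥0) (K : Channel X Y) (R : ℝ≥0) : Prop :=
  ∀ ε : ℝ, 0 < ε → ∃ M₀ : ℕ, ∀ M : ℕ, M₀ ≤ M →
    ∃ (T : ℕ) (P : ℝ≥0), ExistsCode c K T M P ε ∧ (R : ℝ) * (P : ℝ) ≤ Real.logb 2 M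

/-- The capacity per unit cost, possibly infinite: the supremum of the achievable rates per unit
cost (`0` if there is none). -/
def capacityPerUnitCost {X Y : Type*} (c : X → ℝ≥0) (K : Channel X Y) : ℝ≥0∞ :=
  ⨆ (R : ℝ≥0) (_ : Achievable c K R), (R : ℝ≥0∞)

end

end InsDel

/-! Upper bound: reveal the states to the decoder. For a fixed state sequence, the repeated
codewords all have the same length and form a code for the memoryless channel, and the mean cost of
each is `μ` times its original cost. Markov's inequality, applied jointly to the errors and the
costs, yields one state sequence that is good for a fixed positive fraction of the messages
(`Code.exists_states`). Discarding the other messages costs a constant in `log M`, so rate `R` over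
the combined channel gives every rate below `R / μ` over the memoryless one
(`Achievable.of_idc_concat`). If `μ = 0`, the output is empty and no rate is achievable.

Lower bound: a code for the memoryless channel contains a codeword that is easy to test against the
all-zero input. Low test errors force a small Hellinger affinity; the affinity is multiplicative and
the cost additive, so a single symbol `x` can be tested against `x₀` with exponent `τ > R' * c x`,
for any `R' < R` (`Achievable.exists_symbol`).

This symbol is then used for pulse position modulation through the insertions and deletions
(`existsCode_pulse`). With `M` slots of length of order `M`, the input length is of order `M²`, and
by Chebyshev the pulse drifts by at most order `M`. The decoder therefore tests order `M` positions
for each of `M` messages. The union bound over order `M²` tests requires `n * τ > 2 * log M` for a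
pulse of received length `n ≈ μ * k`. This 2, in place of the 1 that a synchronized channel would
need, is the loss in `μ / 2`. -/

namespace InsDel

noncomputable section

/-- The expectation of a nonnegative function under a discrete law. -/
def expect {α : Type*} (p : PMF α) (f : α → ℝ≥0∞) : ℝ≥0∞ := ∑' a, p a * f a

/-! ### Expectations under discrete laws -/

section expect

variable {α β : Type*}

lemma toOuterMeasure_eq_expect (p : PMF α) (A : Set α) :
    p.toOuterMeasure A = expect p (A.indicator 1) := by
  rw [PMF.toOuterMeasure_apply, expect]
  refine tsum_congr fun a => ?_
  by_cases h : a ∈ A <;> simp [h]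

lemma expect_pure (a : α) (f : α → ℝ≥0∞) : expect (PMF.pure a) f = f a := by
  rw [expect, tsum_eq_single a]
  · simp
  · intro b hb
    simp [PMF.pure_apply, hb]

lemma expect_bind (p : PMF α) (q : α → PMF β) (f : β → ℝ≥0∞) :
    expect (p.bind q) f = expect p fun a => expect (q a) f := by
  simp only [expect, PMF.bind_apply, ← ENNReal.tsum_mul_right, ← ENNReal.tsum_mul_left]
  rw [ENNReal.tsum_comm]
  simp only [mul_assoc]

lemma expect_map (p : PMF α) (g : α → β) (f : β → ℝ≥0∞) :
    expect (p.map g) f = expect p (f ∘ g) := by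
  rw [← PMF.bind_pure_comp, expect_bind]
  simp [expect_pure, Function.comp_def]

lemma expect_const (p : PMF α) (x : ℝ≥0∞) : expect p (fun _ => x) = x := by
  rw [expect, ENNReal.tsum_mul_right, p.tsum_coe, one_mul]

lemma expect_add (p : PMF α) (f g : α → ℝ≥0∞) :
    expect p (fun a => f a + g a) = expect p f + expect p g := by
  simp only [expect, mul_add, ENNReal.tsum_add]

lemma expect_const_mul (p : PMF α) (x : ℝ≥0∞) (f : α → ℝ≥0∞) :
    expect p (fun a => x * f a) = x * expect p f := by
  simp only [expect, ← ENNReal.tsum_mul_left]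
  refine tsum_congr fun a => by ring

lemma expect_finset_sum {ι : Type*} (p : PMF α) (s : Finset ι) (f : ι → α → ℝ≥0∞) :
    expect p (fun a => ∑ i ∈ s, f i a) = ∑ i ∈ s, expect p (f i) := by
  classical
  induction s using Finset.induction_on with
  | empty => simpa using expect_const p 0
  | insert i s hi ih => simp [Finset.sum_insert hi, expect_add, ih]

lemma expect_mono_support (p : PMF α) {f g : α → ℝ≥0∞} (h : ∀ a, p a ≠ 0 → f a ≤ g a) :
    expect p f ≤ expect p g := by
  refine ENNReal.tsum_le_tsum fun a => ?_
  by_cases ha : p a = 0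
  · simp [ha]
  · gcongr
    exact h a ha

lemma expect_mono (p : PMF α) {f g : α → ℝ≥0∞} (h : ∀ a, f a ≤ g a) :
    expect p f ≤ expect p g :=
  expect_mono_support p fun a _ => h a

/-- Membership in the support is kept because it determines the length of the state sequence chosen
later. -/
lemma exists_le_expect (p : PMF α) (f : α → ℝ≥0∞) : ∃ a, p a ≠ 0 ∧ f a ≤ expect p f := by
  by_contra! h
  obtain ⟨a₀, ha₀⟩ := p.support_nonempty
  have ha₀ : p a₀ ≠ 0 := (p.mem_support_iff a₀).1 ha₀
  have hfin : expect p f ≠ ⊤ := (h a₀ ha₀).ne_top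
  have hlt : ∑' a, p a * expect p f < ∑' a, p a * f a := by
    refine ENNReal.tsum_lt_tsum (i := a₀) ?_ (fun a => ?_) ?_
    · rw [ENNReal.tsum_mul_right, p.tsum_coe, one_mul]
      exact hfin
    · by_cases ha : p a = 0
      · simp [ha]
      · gcongr
        exact (h a ha).le
    · exact (ENNReal.mul_lt_mul_iff_right ha₀ (p.apply_ne_top a₀)).2 (h a₀ ha₀)
  rw [ENNReal.tsum_mul_right, p.tsum_coe, one_mul] at hlt
  exact lt_irrefl _ hlt

lemma toOuterMeasure_one_le_le_expect (p : PMF α) (f : α → ℝ≥0∞) :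
    p.toOuterMeasure {a | 1 ≤ f a} ≤ expect p f := by
  rw [toOuterMeasure_eq_expect]
  refine expect_mono p fun a => ?_
  by_cases h : 1 ≤ f a <;> simp [h]

lemma toOuterMeasure_le_one (p : PMF α) (A : Set α) : p.toOuterMeasure A ≤ 1 := by
  rw [toOuterMeasure_eq_expect]
  refine (expect_mono p (g := fun _ => 1) fun a => ?_).trans (expect_const p 1).le
  by_cases h : a ∈ A <;> simp [h]

lemma toOuterMeasure_add_compl (p : PMF α) (A : Set α) :
    p.toOuterMeasure A + p.toOuterMeasure Aᶜ = 1 := by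
  rw [toOuterMeasure_eq_expect, toOuterMeasure_eq_expect, ← expect_add]
  refine Eq.trans ?_ (expect_const p 1)
  congr 1
  ext a
  by_cases h : a ∈ A <;> simp [h]

/-- The decoding regions are disjoint. -/
lemma sum_toOuterMeasure_decode_le_one {M : ℕ} (p : PMF α) (decode : α → Option (Fin M)) :
    ∑ m, p.toOuterMeasure {y | decode y = some m} ≤ 1 := by
  simp only [toOuterMeasure_eq_expect]
  rw [← expect_finset_sum]
  refine (expect_mono p (g := fun _ => 1) fun y => ?_).trans (expect_const p 1).le
  simp only [Set.indicator_apply, Set.mem_ofPred_eq, Pi.one_apply]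
  by_cases hd : ∃ m₀, decode y = some m₀
  · obtain ⟨m₀, hm₀⟩ := hd
    simp [hm₀]
  · simp [not_exists.1 hd]

lemma toOuterMeasure_concat {X Y Z : Type*} (K : Channel X Y) (K' : Channel Y Z) (x : List X)
    (A : Set (List Z)) :
    (K.concat K' x).toOuterMeasure A = expect (K x) fun y => (K' y).toOuterMeasure A := by
  rw [Channel.concat, PMF.toOuterMeasure_bind_apply, expect]

end expect

/-! ### Product laws on sequences and their marginals -/

section indep

variable {α : Type*}

lemma expect_indep_cons (p : PMF α) (ps : List (PMF α)) (f : List α → ℝ≥0∞) :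
    expect (indep (p :: ps)) f = expect p fun a => expect (indep ps) fun l => f (a :: l) := by
  rw [indep, expect_bind]
  simp only [expect_map, Function.comp_def]

lemma indep_cons_apply (p : PMF α) (ps : List (PMF α)) (a : α) (l : List α) :
    indep (p :: ps) (a :: l) = p a * indep ps l := by
  classical
  rw [indep, PMF.bind_apply, tsum_eq_single a]
  · rw [PMF.map_apply, tsum_eq_single l]
    · simp
    · intro b hb
      simp [hb.symm]
  · intro b hb
    rw [PMF.map_apply]
    simp [hb.symm]

lemma indep_cons_nil (p : PMF α) (ps : List (PMF α)) : indep (p :: ps) [] = 0 := by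
  rw [indep, PMF.bind_apply]
  simp [PMF.map_apply]

lemma length_eq_of_indep_ne_zero {ps : List (PMF α)} {l : List α} (h : indep ps l ≠ 0) :
    l.length = ps.length := by
  induction ps generalizing l with
  | nil =>
    by_contra hl
    refine h ?_
    rw [indep, PMF.pure_apply, if_neg]
    rintro rfl
    exact hl rfl
  | cons p ps ih =>
    cases l with
    | nil => exact absurd (indep_cons_nil p ps) h
    | cons a l =>
      rw [indep_cons_apply] at h
      simpa using ih (right_ne_zero_of_mul h)

lemma indep_map_take (ps : List (PMF α)) (n : ℕ) :
    (indep ps).map (List.take n) = indep (ps.take n) := by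
  induction ps generalizing n with
  | nil => simp [indep, PMF.pure_map]
  | cons p ps ih =>
    cases n with
    | zero => exact PMF.map_const _ _
    | succ n =>
      simp only [indep, List.take_succ_cons, PMF.map_bind, PMF.map_comp, ← ih]
      rfl

lemma indep_map_drop (ps : List (PMF α)) (n : ℕ) :
    (indep ps).map (List.drop n) = indep (ps.drop n) := by
  induction ps generalizing n with
  | nil => simp [indep, PMF.pure_map]
  | cons p ps ih =>
    cases n with
    | zero => exact PMF.map_id _
    | succ n =>
      simp only [indep, List.drop_succ_cons, PMF.map_bind, PMF.map_comp, ← ih]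
      exact PMF.bind_const p ((indep ps).map (List.drop n))

lemma toOuterMeasure_indep_drop_take (ps : List (PMF α)) (q n : ℕ) (A : Set (List α)) :
    (indep ps).toOuterMeasure {y | (y.drop q).take n ∈ A}
      = (indep ((ps.drop q).take n)).toOuterMeasure A := by
  rw [← indep_map_take, ← indep_map_drop, PMF.map_comp, PMF.toOuterMeasure_map_apply]
  rfl

end indep

/-! ### Moments of the state sums and Chebyshev's inequality -/

section moments

variable {S : PMF ℕ}

lemma expect_indep_replicate_sum (S : PMF ℕ) (n : ℕ) :
    expect (indep (List.replicate n S)) (fun s => (s.sum : ℝ≥0∞))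
      = n * expect S fun k => (k : ℝ≥0∞) := by
  induction n with
  | zero => simp [indep, expect_pure]
  | succ n ih =>
    rw [List.replicate_succ, expect_indep_cons]
    simp only [List.sum_cons, Nat.cast_add, expect_add, expect_const, ih]
    push_cast
    ring

/-- The usual `n * E k² + n * (n - 1) * (E k)²`, with the subtracted term moved to the left because
subtraction in `ℝ≥0∞` is truncated. -/
lemma expect_indep_replicate_sum_sq (S : PMF ℕ) (n : ℕ) :
    expect (indep (List.replicate n S)) (fun s => (s.sum : ℝ≥0∞) ^ 2)
        + n * (expect S fun k => (k : ℝ≥0∞)) ^ 2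
      = n * (expect S fun k => (k : ℝ≥0∞) ^ 2)
        + (n : ℝ≥0∞) ^ 2 * (expect S fun k => (k : ℝ≥0∞)) ^ 2 := by
  induction n with
  | zero => simp [indep, expect_pure]
  | succ n ih =>
    rw [List.replicate_succ, expect_indep_cons]
    have h (a : ℕ) : (expect (indep (List.replicate n S)) fun l => ((a :: l).sum : ℝ≥0∞) ^ 2)
        = (a : ℝ≥0∞) ^ 2 + ((2 * (n * expect S fun k => (k : ℝ≥0∞))) * (a : ℝ≥0∞)
          + expect (indep (List.replicate n S)) (fun s => (s.sum : ℝ≥0∞) ^ 2)) := by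
      rw [← expect_indep_replicate_sum]
      have : (fun l : List ℕ => ((a :: l).sum : ℝ≥0∞) ^ 2)
          = fun l => (a : ℝ≥0∞) ^ 2 + ((2 * a) * (l.sum : ℝ≥0∞) + (l.sum : ℝ≥0∞) ^ 2) := by
        ext l
        push_cast [List.sum_cons]
        ring
      rw [this, expect_add, expect_add, expect_const, expect_const_mul]
      ring
    simp only [h, expect_add, expect_const, expect_const_mul, Nat.cast_succ]
    calc _ = (expect S fun k => (k : ℝ≥0∞) ^ 2) + (2 * n + 1) * (expect S fun k => (k : ℝ≥0∞)) ^ 2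
          + (expect (indep (List.replicate n S)) (fun s => (s.sum : ℝ≥0∞) ^ 2)
            + n * (expect S fun k => (k : ℝ≥0∞)) ^ 2) := by ring
      _ = _ := by rw [ih]; ring

lemma expect_eq_lintegral (S : PMF ℕ) (f : ℕ → ℝ≥0∞) : expect S f = ∫⁻ k, f k ∂S.toMeasure := by
  rw [MeasureTheory.lintegral_countable', expect]
  refine tsum_congr fun k => ?_
  rw [PMF.toMeasure_apply_singleton _ _ (measurableSet_singleton k), mul_comm]

lemma HasMeanVariance.expect_eq {μ σsq : ℝ} (hS : HasMeanVariance S μ σsq) :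
    expect S (fun k => (k : ℝ≥0∞)) = ENNReal.ofReal μ := by
  rw [expect_eq_lintegral, ← hS.2.1,
    MeasureTheory.ofReal_integral_eq_lintegral_ofReal (hS.1.integrable (by norm_num))
      (Filter.Eventually.of_forall fun k => Nat.cast_nonneg k)]
  simp

lemma HasMeanVariance.expect_sq_eq {μ σsq : ℝ} (hS : HasMeanVariance S μ σsq) :
    expect S (fun k => (k : ℝ≥0∞) ^ 2) = ENNReal.ofReal (σsq + μ ^ 2) := by
  have h := ProbabilityTheory.variance_eq_sub hS.1
  rw [hS.2.1, hS.2.2] at h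
  have h' : σsq + μ ^ 2 = ∫ k : ℕ, (k : ℝ) ^ 2 ∂S.toMeasure := by
    rw [h]
    simp
  rw [expect_eq_lintegral, h', MeasureTheory.ofReal_integral_eq_lintegral_ofReal hS.1.integrable_sq
      (Filter.Eventually.of_forall fun k => sq_nonneg _)]
  simp [ENNReal.ofReal_pow]

lemma HasMeanVariance.mean_nonneg {μ σsq : ℝ} (hS : HasMeanVariance S μ σsq) : 0 ≤ μ := by
  rw [← hS.2.1]
  exact MeasureTheory.integral_nonneg fun k => Nat.cast_nonneg k

lemma HasMeanVariance.variance_nonneg {μ σsq : ℝ} (hS : HasMeanVariance S μ σsq) : 0 ≤ σsq := by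
  rw [← hS.2.2]
  exact ProbabilityTheory.variance_nonneg _ _

lemma HasMeanVariance.expect_sub_sq {μ σsq : ℝ} (hS : HasMeanVariance S μ σsq) (n : ℕ) :
    expect (indep (List.replicate n S)) (fun s => ENNReal.ofReal ((s.sum - n * μ) ^ 2))
      = ENNReal.ofReal (n * σsq) := by
  have hμ := hS.mean_nonneg
  have hσ := hS.variance_nonneg
  have h1 := expect_indep_replicate_sum S n
  have h2 := expect_indep_replicate_sum_sq S n
  rw [hS.expect_eq] at h1 h2
  rw [hS.expect_sq_eq] at h2
  -- The expanded square with its cross term moved to the left; since the sum has mean `n * μ`, that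
  -- term is a constant in expectation.
  have key : expect (indep (List.replicate n S)) (fun s => ENNReal.ofReal ((s.sum - n * μ) ^ 2))
      + 2 * (n * ENNReal.ofReal μ) * (n * ENNReal.ofReal μ)
      = expect (indep (List.replicate n S)) (fun s => (s.sum : ℝ≥0∞) ^ 2)
        + (n * ENNReal.ofReal μ) ^ 2 := by
    have hlin : 2 * (n * ENNReal.ofReal μ) * (n * ENNReal.ofReal μ)
        = expect (indep (List.replicate n S))
          fun s => 2 * (n * ENNReal.ofReal μ) * (s.sum : ℝ≥0∞) := by
      rw [expect_const_mul, h1]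
    rw [hlin, ← expect_add, ← expect_const (indep (List.replicate n S))
      ((n * ENNReal.ofReal μ) ^ 2), ← expect_add]
    congr 1
    ext s
    rw [← ENNReal.ofReal_natCast s.sum, ← ENNReal.ofReal_natCast n,
      ← ENNReal.ofReal_mul (by positivity), ← ENNReal.ofReal_ofNat 2,
      ← ENNReal.ofReal_mul (by positivity), ← ENNReal.ofReal_mul (by positivity),
      ← ENNReal.ofReal_pow (by positivity), ← ENNReal.ofReal_pow (by positivity),
      ← ENNReal.ofReal_add (by positivity) (by positivity),
      ← ENNReal.ofReal_add (by positivity) (by positivity)]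
    congr 1
    ring
  have hadd : ENNReal.ofReal (σsq + μ ^ 2) = ENNReal.ofReal σsq + ENNReal.ofReal μ ^ 2 := by
    rw [ENNReal.ofReal_add hσ (by positivity), ENNReal.ofReal_pow hμ]
  have hfin : 2 * (n * ENNReal.ofReal μ) * (n * ENNReal.ofReal μ) + n * ENNReal.ofReal μ ^ 2 ≠ ⊤ := by
    finiteness
  rw [ENNReal.ofReal_mul (by positivity), ENNReal.ofReal_natCast]
  refine (ENNReal.add_left_inj hfin).1 ?_
  rw [← add_assoc, key, add_right_comm, h2, hadd]
  ring

lemma HasMeanVariance.deviation_le {μ σsq : ℝ} (hS : HasMeanVariance S μ σsq) (n : ℕ) {d : ℝ}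
    (hd : 0 < d) :
    (indep (List.replicate n S)).toOuterMeasure {s | d ≤ |(s.sum : ℝ) - n * μ|}
      ≤ ENNReal.ofReal (n * σsq / d ^ 2) := by
  have hd2 : (0 : ℝ) < d ^ 2 := by positivity
  refine le_trans (MeasureTheory.measure_mono ?_) ((toOuterMeasure_one_le_le_expect _
    fun s => ENNReal.ofReal ((d ^ 2)⁻¹) * ENNReal.ofReal ((s.sum - n * μ) ^ 2)).trans ?_)
  · intro s hs
    simp only [Set.mem_ofPred_eq] at hs ⊢
    rw [← ENNReal.ofReal_mul (by positivity), ENNReal.one_le_ofReal, ← sq_abs (_ - _),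
      inv_mul_eq_div, one_le_div hd2]
    gcongr
  · rw [expect_const_mul, hS.expect_sub_sq, ← ENNReal.ofReal_mul (by positivity), inv_mul_eq_div]

end moments

/-! ### Symbol repetition and its effect on the cost -/

section repeatSymbols

variable {X : Type*}

lemma repeatSymbols_cons (k : ℕ) (s : List ℕ) (a : X) (x : List X) :
    repeatSymbols (k :: s) (a :: x) = List.replicate k a ++ repeatSymbols s x := rfl

lemma length_repeatSymbols {s : List ℕ} {x : List X} (h : s.length = x.length) :
    (repeatSymbols s x).length = s.sum := by
  induction s generalizing x with
  | nil => simp [repeatSymbols]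
  | cons k s ih =>
    cases x with
    | nil => simp at h
    | cons a x =>
      rw [repeatSymbols_cons, List.length_append, List.length_replicate, List.sum_cons,
        ih (by simpa using h)]

lemma seqCost_append (c : X → ℝ≥0) (x y : List X) :
    seqCost c (x ++ y) = seqCost c x + seqCost c y := by
  simp [seqCost]

lemma seqCost_replicate (c : X → ℝ≥0) (k : ℕ) (a : X) :
    seqCost c (List.replicate k a) = k * c a := by
  simp [seqCost]

lemma expect_idc (S : PMF ℕ) (x : List X) (f : List X → ℝ≥0∞) :
    expect (idc S x) f
      = expect (indep (List.replicate x.length S)) fun s => f (repeatSymbols s x) := by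
  rw [idc, expect_map]
  rfl

lemma expect_seqCost_repeatSymbols (c : X → ℝ≥0) (S : PMF ℕ) (x : List X) :
    expect (indep (List.replicate x.length S)) (fun s => (seqCost c (repeatSymbols s x) : ℝ≥0∞))
      = (expect S fun k => (k : ℝ≥0∞)) * seqCost c x := by
  induction x with
  | nil => simp [indep, expect_pure, repeatSymbols, seqCost]
  | cons a x ih =>
    rw [List.length_cons, List.replicate_succ, expect_indep_cons]
    have h (k : ℕ) : (expect (indep (List.replicate x.length S)) fun l =>
        (seqCost c (repeatSymbols (k :: l) (a :: x)) : ℝ≥0∞))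
        = c a * k + (expect S fun k => (k : ℝ≥0∞)) * seqCost c x := by
      rw [← ih, ← expect_const (indep (List.replicate x.length S)) ((c a : ℝ≥0∞) * k),
        ← expect_add]
      congr 1
      ext l
      rw [repeatSymbols_cons, seqCost_append, seqCost_replicate]
      push_cast
      ring
    simp only [h, expect_add, expect_const_mul, expect_const]
    simp [seqCost]
    ring

end repeatSymbols

/-! ### The upper bound: a decoder informed of the states -/

section code

variable {X Y : Type*}

lemma Code.errorProb_le_iff {T M : ℕ} (hM : M ≠ 0) (C : Code X Y T M) (K : Channel X Y)
    (e : ℝ≥0∞) : C.errorProb K ≤ e ↔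
      ∑ m, (K (C.word m)).toOuterMeasure {y | C.decode y ≠ some m} ≤ e * M := by
  rw [Code.errorProb, ENNReal.div_le_iff (by exact_mod_cast hM) (ENNReal.natCast_ne_top M)]

/-- A large set of messages with good codewords forms a code. -/
lemma existsCode_of_subset {c : X → ℝ≥0} {K : Channel X Y} {T M M' : ℕ} (hM' : M' ≠ 0)
    (x : Fin M → List X) (hx : ∀ m, (x m).length = T) (decode : List Y → Option (Fin M))
    (I : Finset (Fin M)) (hI : M' ≤ I.card) {P : ℝ≥0} {ε : ℝ}
    (hcost : ∀ m ∈ I, seqCost c (x m) ≤ P)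
    (herr : ∀ m ∈ I, (K (x m)).toOuterMeasure {y | decode y ≠ some m} ≤ ENNReal.ofReal ε) :
    ExistsCode c K T M' P ε := by
  obtain ⟨I', hI', hcard⟩ := Finset.exists_subset_card_eq hI
  let g : Fin M' ↪o Fin M := I'.orderEmbOfFin hcard
  have hg (i : Fin M') : g i ∈ I := hI' (I'.orderEmbOfFin_mem hcard i)
  -- `partialInv g` relabels the retained messages; decoding to a discarded message becomes a
  -- declared error.
  refine ⟨⟨fun i => x (g i), fun i => hx _, fun y => (decode y).bind (Function.partialInv g)⟩,
    fun i => hcost _ (hg i), ?_⟩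
  rw [Code.errorProb_le_iff hM']
  calc _ ≤ ∑ _i : Fin M', ENNReal.ofReal ε := Finset.sum_le_sum fun i _ => ?_
    _ = _ := by simp [mul_comm]
  refine (MeasureTheory.measure_mono fun y hy => ?_).trans (herr _ (hg i))
  simp only [Set.mem_ofPred_eq] at hy ⊢
  refine fun h => hy ?_
  rw [h, Option.bind_some, Function.partialInv_left g.injective]

lemma exists_one_add_mul_lt {a b : ℝ} (ha : 0 ≤ a) (hab : a < b) :
    ∃ δ : ℝ, 0 < δ ∧ a * (1 + δ) < b := by
  refine ⟨(b - a) / (2 * (a + 1)), by apply div_pos <;> linarith, ?_⟩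
  have h : a * ((b - a) / (2 * (a + 1))) ≤ (b - a) / 2 := by
    rw [mul_div_assoc', div_le_div_iff₀ (by positivity) (by positivity)]
    nlinarith
  linarith

/-- Informing the decoder of the states of the insertion/deletion channel: one of the state
sequences is good for a positive fraction of the messages. -/
lemma Code.exists_states {c : X → ℝ≥0} {K : Channel X Y} {S : PMF ℕ} {μ σsq : ℝ}
    (hS : HasMeanVariance S μ σsq) {T M : ℕ} (C : Code X Y T M) (hM : M ≠ 0) {P P' : ℝ≥0}
    {ε ρ : ℝ} (hε : 0 < ε) (hP' : 0 < P') (hP : ∀ m, seqCost c (C.word m) ≤ P)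
    (hρ : 0 < ρ) (hPP' : μ * P ≤ (1 - 2 * ρ) * P')
    (hC : C.errorProb ((idc S).concat K) ≤ ENNReal.ofReal (ε * ρ)) :
    ∃ s : List ℕ, s.length = T ∧ ∃ I : Finset (Fin M), ρ * M ≤ I.card ∧
      (∀ m ∈ I, seqCost c (repeatSymbols s (C.word m)) ≤ P') ∧
      ∀ m ∈ I, (K (repeatSymbols s (C.word m))).toOuterMeasure {y | C.decode y ≠ some m}
        ≤ ENNReal.ofReal ε := by
  classical
  have hμ := hS.mean_nonneg
  have hε0 : ENNReal.ofReal ε ≠ 0 := by simpa using hε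
  have hP0 : (P' : ℝ≥0∞) ≠ 0 := by exact_mod_cast hP'.ne'
  let err (m : Fin M) (s : List ℕ) : ℝ≥0∞ :=
    (K (repeatSymbols s (C.word m))).toOuterMeasure {y | C.decode y ≠ some m}
  let cost (m : Fin M) (s : List ℕ) : ℝ≥0∞ := seqCost c (repeatSymbols s (C.word m))
  -- One functional for both constraints: `f m s ≤ 1` forces error at most `ε` and cost at most
  -- `P'`. In the mean over the states, the errors contribute at most `ρ * M` to the sum and the
  -- costs at most `(1 - 2 * ρ) * M`.
  let f (m : Fin M) (s : List ℕ) : ℝ≥0∞ :=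
    (ENNReal.ofReal ε)⁻¹ * err m s + (P' : ℝ≥0∞)⁻¹ * cost m s
  let p := indep (List.replicate T S)
  have herr : ∑ m, expect p (err m) ≤ ENNReal.ofReal (ε * ρ) * M := by
    rw [Code.errorProb_le_iff hM] at hC
    refine le_of_eq_of_le (Finset.sum_congr rfl fun m _ => ?_) hC
    rw [toOuterMeasure_concat, expect_idc, C.length_word]
  have hcost (m : Fin M) : expect p (cost m) ≤ ENNReal.ofReal (μ * P) := by
    have h := expect_seqCost_repeatSymbols c S (C.word m)
    rw [C.length_word, hS.expect_eq] at h
    refine h.le.trans ?_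
    rw [ENNReal.ofReal_mul hμ, ENNReal.ofReal_coe_nnreal]
    gcongr
    exact hP m
  have hmean : expect p (fun s => ∑ m, f m s) ≤ ENNReal.ofReal ((1 - ρ) * M) := by
    have hle : 0 ≤ (1 - 2 * ρ) := by
      by_contra! h
      nlinarith [mul_nonneg hμ P.2, NNReal.coe_pos.2 hP']
    calc expect p (fun s => ∑ m, f m s)
        = (ENNReal.ofReal ε)⁻¹ * ∑ m, expect p (err m)
          + (P' : ℝ≥0∞)⁻¹ * ∑ m, expect p (cost m) := by
          rw [expect_finset_sum, Finset.mul_sum, Finset.mul_sum, ← Finset.sum_add_distrib]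
          refine Finset.sum_congr rfl fun m _ => ?_
          rw [← expect_const_mul, ← expect_const_mul, ← expect_add]
      _ ≤ (ENNReal.ofReal ε)⁻¹ * (ENNReal.ofReal (ε * ρ) * M)
          + (P' : ℝ≥0∞)⁻¹ * ∑ _m : Fin M, ENNReal.ofReal (μ * P) := by
          gcongr
          exact hcost _
      _ ≤ ENNReal.ofReal (ρ * M) + ENNReal.ofReal ((1 - 2 * ρ) * M) := by
          gcongr
          · rw [ENNReal.ofReal_mul hε.le, mul_assoc, ← mul_assoc,
              ENNReal.inv_mul_cancel hε0 ENNReal.ofReal_ne_top, one_mul, ENNReal.ofReal_mul hρ.le,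
              ENNReal.ofReal_natCast]
          · rw [Finset.sum_const, Finset.card_univ, Fintype.card_fin, nsmul_eq_mul]
            calc (P' : ℝ≥0∞)⁻¹ * (M * ENNReal.ofReal (μ * P))
                ≤ (P' : ℝ≥0∞)⁻¹ * (M * ENNReal.ofReal ((1 - 2 * ρ) * P')) := by gcongr
              _ = _ := by
                rw [ENNReal.ofReal_mul hle, ENNReal.ofReal_mul hle, ENNReal.ofReal_natCast,
                  ENNReal.ofReal_coe_nnreal]
                calc _ = ((P' : ℝ≥0∞)⁻¹ * P') * (ENNReal.ofReal (1 - 2 * ρ) * M) := by ring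
                  _ = _ := by rw [ENNReal.inv_mul_cancel hP0 ENNReal.coe_ne_top, one_mul]
      _ = _ := by
          rw [← ENNReal.ofReal_add (by positivity) (by positivity)]
          congr 1
          ring
  obtain ⟨s, hs, hsf⟩ := exists_le_expect p fun s => ∑ m, f m s
  have hsf := hsf.trans hmean
  have hρ1 : 0 ≤ (1 - ρ) * M := by
    have : 0 ≤ (1 - 2 * ρ) := by
      by_contra! h
      nlinarith [mul_nonneg hμ P.2, NNReal.coe_pos.2 hP']
    have : 0 ≤ 1 - ρ := by linarith
    positivity
  refine ⟨s, by simpa using length_eq_of_indep_ne_zero hs,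
    Finset.univ.filter fun m => f m s ≤ 1, ?_, fun m hm => ?_, fun m hm => ?_⟩
  -- Each bad message contributes more than 1 to a sum of at most `(1 - ρ) * M`.
  · have hbad : (((Finset.univ.filter fun m => ¬ f m s ≤ 1).card : ℕ) : ℝ≥0∞)
        ≤ ENNReal.ofReal ((1 - ρ) * M) := by
      refine le_trans ?_ hsf
      rw [← nsmul_one, ← Finset.sum_const]
      refine (Finset.sum_le_sum fun m hm => ?_).trans
        (Finset.sum_le_sum_of_subset (Finset.filter_subset _ _))
      exact (not_le.1 (Finset.mem_filter.1 hm).2).le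
    rw [← ENNReal.ofReal_natCast, ENNReal.ofReal_le_ofReal_iff hρ1] at hbad
    have hsum := Finset.card_filter_add_card_filter_not (s := (Finset.univ : Finset (Fin M)))
      fun m => f m s ≤ 1
    rw [Finset.card_univ, Fintype.card_fin] at hsum
    have hsum' : ((Finset.univ.filter fun m => f m s ≤ 1).card : ℝ)
        + (Finset.univ.filter fun m => ¬ f m s ≤ 1).card = M := by exact_mod_cast hsum
    linarith
  · have h := (Finset.mem_filter.1 hm).2
    have h : (P' : ℝ≥0∞)⁻¹ * cost m s ≤ 1 := le_add_self.trans h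
    rw [mul_comm, ← div_eq_mul_inv, ENNReal.div_le_iff hP0 ENNReal.coe_ne_top, one_mul] at h
    exact ENNReal.coe_le_coe.1 h
  · have h := (Finset.mem_filter.1 hm).2
    have h : (ENNReal.ofReal ε)⁻¹ * err m s ≤ 1 := le_self_add.trans h
    rwa [mul_comm, ← div_eq_mul_inv, ENNReal.div_le_iff hε0 ENNReal.ofReal_ne_top, one_mul] at h

lemma Achievable.of_idc_concat {c : X → ℝ≥0} {K : Channel X Y} {S : PMF ℕ} {μ σsq : ℝ}
    (hS : HasMeanVariance S μ σsq) (hμ : 0 < μ) {R R' : ℝ≥0} (hR : R' * μ < R)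
    (h : Achievable c ((idc S).concat K) R) : Achievable c K R' := by
  intro ε hε
  obtain ⟨δ, hδ, hδR⟩ := exists_one_add_mul_lt (mul_nonneg R'.2 hμ.le) hR
  have hR0 : (0 : ℝ) < R := lt_of_le_of_lt (mul_nonneg R'.2 hμ.le) hR
  -- Chosen so that `(1 - 2 * ρ) * (1 + δ) = 1`, which matches the cost slack `1 + δ` in `P'`.
  set ρ : ℝ := δ / (2 * (1 + δ)) with hρ
  have hρ0 : 0 < ρ := by positivity
  have hρδ : (1 - 2 * ρ) * (1 + δ) = 1 := by
    rw [hρ]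
    field_simp
    ring
  -- Starting from `J * M'` messages, the good fraction `ρ` still contains `M'` of them.
  obtain ⟨J, hJ⟩ := exists_nat_ge ρ⁻¹
  have hJ0 : (0 : ℝ) < J := lt_of_lt_of_le (by positivity) hJ
  have hJρ : 1 ≤ ρ * J := by rwa [← div_le_iff₀' hρ0, one_div]
  have hJ1 : 1 ≤ J := by exact_mod_cast hJ0
  set θ : ℝ := R' * μ * (1 + δ) / R with hθ
  have hθ1 : θ < 1 := (div_lt_one hR0).2 hδR
  obtain ⟨M₀, hM₀⟩ := h (ε * ρ) (by positivity)
  -- Beyond `N`, the slack `(1 - θ) * log M'` absorbs the constant `θ * log J`.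
  obtain ⟨N, hN⟩ := exists_nat_ge ((2 : ℝ) ^ (θ * Real.logb 2 J / (1 - θ)))
  refine ⟨max (max M₀ N) 2, fun M' hM' => ?_⟩
  have hM2 : 2 ≤ M' := (le_max_right _ _).trans hM'
  have hMM₀ : M₀ ≤ M' := (le_max_left _ _).trans ((le_max_left _ _).trans hM')
  have hMN : N ≤ M' := (le_max_right _ _).trans ((le_max_left _ _).trans hM')
  have hM'0 : (0 : ℝ) < M' := by positivity
  obtain ⟨T, P, ⟨C, hCP, hC⟩, hRP⟩ := hM₀ (J * M') (hMM₀.trans (Nat.le_mul_of_pos_left _ hJ1))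
  have hlog : Real.logb 2 ((J * M' : ℕ) : ℝ) = Real.logb 2 J + Real.logb 2 M' := by
    rw [Nat.cast_mul, Real.logb_mul hJ0.ne' hM'0.ne']
  rw [hlog] at hRP
  have hlogJ : 0 ≤ Real.logb 2 J := Real.logb_nonneg (by norm_num) (by exact_mod_cast hJ1)
  have hlogM : 0 < Real.logb 2 M' :=
    Real.logb_pos (by norm_num) (by exact_mod_cast hM2)
  have hlogN : θ * Real.logb 2 J / (1 - θ) ≤ Real.logb 2 M' := by
    rw [Real.le_logb_iff_rpow_le (by norm_num) hM'0]
    exact hN.trans (by exact_mod_cast hMN)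
  rw [div_le_iff₀ (by linarith)] at hlogN
  -- The bound `log (J * M') / R` replaces `P`, which may vanish, whereas `P'` has to be positive.
  set P' : ℝ≥0 := ⟨(1 + δ) * (μ * ((Real.logb 2 J + Real.logb 2 M') / R)), by positivity⟩ with hP'
  have hP'coe : (P' : ℝ) = (1 + δ) * (μ * ((Real.logb 2 J + Real.logb 2 M') / R)) := rfl
  have hP'0 : 0 < P' := by
    rw [← NNReal.coe_pos, hP'coe]
    positivity
  obtain ⟨s, hs, I, hI, hcost, herr⟩ := C.exists_states (K := K) (P' := P') hS
    (by positivity) hε hP'0 hCP hρ0 (by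
      rw [hP'coe, ← mul_assoc, hρδ, one_mul]
      gcongr
      rwa [le_div_iff₀' hR0]) hC
  refine ⟨s.sum, P', existsCode_of_subset (by positivity) (fun m => repeatSymbols s (C.word m))
    (fun m => length_repeatSymbols (by rw [hs, C.length_word])) C.decode I ?_ hcost herr, ?_⟩
  · have : (M' : ℝ) ≤ I.card := by
      refine le_trans ?_ hI
      push_cast
      nlinarith
    exact_mod_cast this
  · calc (R' : ℝ) * P' = θ * (Real.logb 2 J + Real.logb 2 M') := by
          rw [hP'coe, hθ]
          ring
      _ ≤ _ := by linarith

/-- All states vanish almost surely, so the decoder sees the empty sequence and its correct-decoding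
probabilities sum to at most 1. For `M ≥ 2` the average error is then at least `1 / 2`. -/
lemma not_achievable_of_mean_zero {c : X → ℝ≥0} {W : X → PMF Y} {S : PMF ℕ} {σsq : ℝ}
    (hS : HasMeanVariance S 0 σsq) (R : ℝ≥0) :
    ¬ Achievable c ((idc S).concat (dmc W)) R := by
  intro h
  obtain ⟨M₀, hM₀⟩ := h (1 / 4) (by norm_num)
  obtain ⟨M, hM2, hMM₀⟩ : ∃ M, 2 ≤ M ∧ M₀ ≤ M := ⟨max M₀ 2, le_max_right _ _, le_max_left _ _⟩
  obtain ⟨T, P, ⟨C, -, hC⟩, -⟩ := hM₀ M hMM₀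
  rw [Code.errorProb_le_iff (by positivity)] at hC
  have hsupp : ∀ k, S k ≠ 0 → k = 0 := by
    intro k hk
    have h0 := hS.expect_eq
    rw [ENNReal.ofReal_zero, expect, ENNReal.tsum_eq_zero] at h0
    simpa [hk] using h0 k
  have hS0 : S = PMF.pure 0 := by
    ext k
    by_cases hk : k = 0
    · subst hk
      have h1 := S.tsum_coe
      rw [tsum_eq_single 0 fun k hk => by_contra fun h => hk (hsupp k h)] at h1
      simp [h1]
    · rw [PMF.pure_apply, if_neg hk]
      exact by_contra fun h => hk (hsupp k h)
  have hout (x : List X) : (idc S).concat (dmc W) x = PMF.pure [] := by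
    have hind (n : ℕ) : indep (List.replicate n S) = PMF.pure (List.replicate n 0) := by
      induction n with
      | zero => rfl
      | succ n ih => rw [List.replicate_succ, indep, ih, hS0, PMF.pure_bind, PMF.pure_map]; rfl
    have hrep : repeatSymbols (List.replicate x.length 0) x = [] := by
      induction x with
      | nil => rfl
      | cons a x ih => rw [List.length_cons, List.replicate_succ, repeatSymbols_cons, ih]; rfl
    rw [Channel.concat, idc, hind, PMF.pure_map, PMF.pure_bind, hrep]
    rfl
  simp only [hout] at hC
  have hsum : (M : ℝ≥0∞) ≤ ∑ m : Fin M, (PMF.pure ([] : List Y)).toOuterMeasure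
      {y | C.decode y ≠ some m} + 1 := by
    refine le_trans ?_ (add_le_add_right
      (sum_toOuterMeasure_decode_le_one (PMF.pure ([] : List Y)) C.decode) _)
    rw [← Finset.sum_add_distrib]
    refine le_of_eq ?_
    have (m : Fin M) : (PMF.pure ([] : List Y)).toOuterMeasure {y | C.decode y ≠ some m}
        + (PMF.pure ([] : List Y)).toOuterMeasure {y | C.decode y = some m} = 1 := by
      rw [add_comm]
      exact toOuterMeasure_add_compl _ {y | C.decode y = some m}
    simp only [this, Finset.sum_const, Finset.card_univ, Fintype.card_fin, nsmul_eq_mul, mul_one]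
  have hle := hsum.trans (add_le_add_left hC 1)
  rw [← ENNReal.ofReal_natCast, ← ENNReal.ofReal_mul (by norm_num), ← ENNReal.ofReal_one,
    ← ENNReal.ofReal_add (by positivity) (by norm_num),
    ENNReal.ofReal_le_ofReal_iff (by positivity)] at hle
  have : (2 : ℝ) ≤ M := by exact_mod_cast hM2
  linarith

lemma capacityPerUnitCost_idc_concat_le (W : X → PMF Y) (c : X → ℝ≥0) {S : PMF ℕ} {μ σsq : ℝ}
    (hS : HasMeanVariance S μ σsq) :
    capacityPerUnitCost c ((idc S).concat (dmc W))
      ≤ ENNReal.ofReal μ * capacityPerUnitCost c (dmc W) := by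
  refine iSup₂_le fun R hR => ?_
  rcases hS.mean_nonneg.eq_or_lt with rfl | hμ
  · exact absurd hR (not_achievable_of_mean_zero hS R)
  have hμ0 : ENNReal.ofReal μ ≠ 0 := by simpa using hμ
  rw [mul_comm, ← ENNReal.div_le_iff hμ0 ENNReal.ofReal_ne_top]
  refine ENNReal.le_of_forall_nnreal_lt fun R' hR' => ?_
  refine le_iSup₂_of_le R' (hR.of_idc_concat hS hμ ?_) le_rfl
  rw [ENNReal.lt_div_iff_mul_lt (Or.inl hμ0) (Or.inl ENNReal.ofReal_ne_top),
    ← ENNReal.ofReal_coe_nnreal, ← ENNReal.ofReal_mul R'.coe_nonneg, ← ENNReal.ofReal_coe_nnreal] at hR'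
  exact (ENNReal.ofReal_lt_ofReal_iff_of_nonneg (mul_nonneg R'.2 hμ.le)).1 hR'

end code

/-- The Hellinger affinity of order `s` of two laws. -/
def affinity {α : Type*} (s : ℝ) (p q : PMF α) : ℝ≥0∞ := ∑' a, p a ^ (1 - s) * q a ^ s

/-! ### Hellinger affinity and hypothesis testing -/

section affinity

variable {α : Type*} {s : ℝ}

lemma tsum_rpow_mul_rpow_le (hs0 : 0 ≤ s) (hs1 : s ≤ 1) (f g : α → ℝ≥0∞) :
    ∑' a, f a ^ (1 - s) * g a ^ s ≤ (∑' a, f a) ^ (1 - s) * (∑' a, g a) ^ s := by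
  let _ : MeasurableSpace α := ⊤
  have h := ENNReal.lintegral_mul_norm_pow_le (μ := MeasureTheory.Measure.count)
    (measurable_from_top (f := f)).aemeasurable (measurable_from_top (f := g)).aemeasurable
    (sub_nonneg.2 hs1) hs0 (by ring)
  simpa only [MeasureTheory.lintegral_count] using h

/-- Hölder's inequality on `A` and on `Aᶜ` separately, bounding one factor by 1 in each. -/
lemma affinity_le (hs0 : 0 < s) (hs1 : s < 1) (p q : PMF α) (A : Set α) :
    affinity s p q ≤ p.toOuterMeasure Aᶜ ^ (1 - s) + q.toOuterMeasure A ^ s := by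
  have hs1' : 0 < 1 - s := sub_pos.2 hs1
  have hsplit : affinity s p q
      = ∑' a, Aᶜ.indicator p a ^ (1 - s) * Aᶜ.indicator q a ^ s
        + ∑' a, A.indicator p a ^ (1 - s) * A.indicator q a ^ s := by
    rw [affinity, ← ENNReal.tsum_add]
    refine tsum_congr fun a => ?_
    by_cases h : a ∈ A <;> simp [h, hs0, hs1']
  rw [hsplit]
  refine add_le_add ((tsum_rpow_mul_rpow_le hs0.le hs1.le _ _).trans ?_)
    ((tsum_rpow_mul_rpow_le hs0.le hs1.le _ _).trans ?_)
  · rw [← PMF.toOuterMeasure_apply, ← PMF.toOuterMeasure_apply]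
    exact mul_le_of_le_one_right' (ENNReal.rpow_le_one (toOuterMeasure_le_one q _) hs0.le)
  · rw [← PMF.toOuterMeasure_apply, ← PMF.toOuterMeasure_apply]
    exact mul_le_of_le_one_left' (ENNReal.rpow_le_one (toOuterMeasure_le_one p _) hs1'.le)

/-- The Chernoff bound: where `p < θ * q`, write `p = p ^ (1 - s) * p ^ s` and enlarge the second
factor. -/
lemma toOuterMeasure_lt_mul_le_affinity (hs0 : 0 ≤ s) (hs1 : s ≤ 1) (p q : PMF α) (θ : ℝ≥0∞) :
    p.toOuterMeasure {a | p a < θ * q a} ≤ θ ^ s * affinity s p q := by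
  rw [PMF.toOuterMeasure_apply, affinity, ← ENNReal.tsum_mul_left]
  refine ENNReal.tsum_le_tsum fun a => ?_
  by_cases h : p a < θ * q a
  · rw [Set.indicator_of_mem (s := {a | p a < θ * q a}) h]
    calc p a = p a ^ (1 - s) * p a ^ s := by
          rw [← ENNReal.rpow_add_of_nonneg _ _ (sub_nonneg.2 hs1) hs0, sub_add_cancel,
            ENNReal.rpow_one]
      _ ≤ p a ^ (1 - s) * (θ * q a) ^ s := by gcongr
      _ = _ := by rw [ENNReal.mul_rpow_of_nonneg _ _ hs0]; ring
  · rw [Set.indicator_of_notMem (s := {a | p a < θ * q a}) h]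
    exact zero_le

lemma affinity_indep {ι : Type*} (hs0 : 0 < s) (hs1 : s < 1) (f g : ι → PMF α) (l : List ι) :
    affinity s (indep (l.map f)) (indep (l.map g)) = (l.map fun i => affinity s (f i) (g i)).prod := by
  have hs1' : 0 < 1 - s := sub_pos.2 hs1
  induction l with
  | nil =>
    rw [affinity, tsum_eq_single []]
    · simp [indep]
    · intro z hz
      simp [indep, PMF.pure_apply, hz, hs0]
  | cons i l ih =>
    have hinj : Function.Injective fun z : α × List α => z.1 :: z.2 := by
      rintro ⟨a, y⟩ ⟨b, z⟩ h
      simpa using h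
    rw [affinity, ← hinj.tsum_eq, List.map_cons, List.map_cons, List.map_cons, List.prod_cons, ← ih,
      affinity, affinity, ← ENNReal.tsum_mul_right, ENNReal.tsum_prod (f := fun a y =>
        indep (f i :: l.map f) (a :: y) ^ (1 - s) * indep (g i :: l.map g) (a :: y) ^ s)]
    · refine tsum_congr fun a => ?_
      rw [← ENNReal.tsum_mul_left]
      refine tsum_congr fun y => ?_
      rw [indep_cons_apply, indep_cons_apply, ENNReal.mul_rpow_of_nonneg _ _ hs0.le,
        ENNReal.mul_rpow_of_nonneg _ _ hs1'.le]
      ring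
    · intro z hz
      cases z with
      | nil =>
        refine absurd ?_ hz
        simp [indep_cons_nil, hs0]
      | cons a z => exact ⟨(a, z), rfl⟩

end affinity

/-! ### From a code to one distinguishable symbol -/

lemma two_rpow_add (x y : ℝ) : (2 : ℝ≥0∞) ^ (x + y) = 2 ^ x * 2 ^ y :=
  ENNReal.rpow_add _ _ (by norm_num) (by norm_num)

lemma two_rpow_le_prod {X : Type*} (c : X → ℝ≥0) (t : ℝ) (f : X → ℝ≥0∞) (x : List X)
    (h : ∀ a ∈ x, (2 : ℝ≥0∞) ^ (t * c a) ≤ f a) : (2 : ℝ≥0∞) ^ (t * seqCost c x) ≤ (x.map f).prod := by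
  refine le_of_eq_of_le ?_ (List.prod_le_prod' h)
  induction x with
  | nil => simp [seqCost]
  | cons a x ih =>
    rw [List.map_cons, List.prod_cons, ← ih fun b hb => h b (List.mem_cons_of_mem a hb),
      ← two_rpow_add, ← mul_add]
    simp [seqCost]

lemma two_rpow_logb {M : ℕ} (hM : M ≠ 0) : (2 : ℝ≥0∞) ^ Real.logb 2 M = M := by
  rw [← ENNReal.ofReal_ofNat 2, ENNReal.ofReal_rpow_of_pos (by norm_num),
    Real.rpow_logb (by norm_num) (by norm_num) (by positivity), ENNReal.ofReal_natCast]

/-- A code contains a codeword that can be tested against the all-zero input with probability of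
missed detection at most twice the probability of decoding error, and probability of false alarm at
most `2 / M`. -/
lemma Code.exists_test {X Y : Type*} {T M : ℕ} (C : Code X Y T M) (hM : M ≠ 0) (K : Channel X Y)
    (q : PMF (List Y)) {e : ℝ≥0∞} (he0 : e ≠ 0) (he : e ≠ ⊤) (hC : C.errorProb K ≤ e) :
    ∃ m, ∃ A : Set (List Y), (K (C.word m)).toOuterMeasure Aᶜ ≤ 2 * e ∧
      q.toOuterMeasure A ≤ 2 * (M : ℝ≥0∞)⁻¹ := by
  have hM0 : (M : ℝ≥0∞) ≠ 0 := by exact_mod_cast hM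
  have hMt : (M : ℝ≥0∞) ≠ ⊤ := ENNReal.natCast_ne_top M
  rw [Code.errorProb_le_iff hM] at hC
  -- The weights make each of the two sums at most `M / 2`, so some message has `f m ≤ 1`.
  let f (m : Fin M) : ℝ≥0∞ := (2 * e)⁻¹ * (K (C.word m)).toOuterMeasure {y | C.decode y ≠ some m}
    + 2⁻¹ * M * q.toOuterMeasure {y | C.decode y = some m}
  have h2 : (2 : ℝ≥0∞)⁻¹ + 2⁻¹ = 1 := ENNReal.inv_two_add_inv_two
  have hsum : ∑ m, f m ≤ M := by
    rw [Finset.sum_add_distrib, ← Finset.mul_sum, ← Finset.mul_sum]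
    calc _ ≤ (2 * e)⁻¹ * (e * M) + 2⁻¹ * M * 1 := by
          gcongr
          exact sum_toOuterMeasure_decode_le_one q C.decode
      _ = 2⁻¹ * (e⁻¹ * e) * M + 2⁻¹ * M := by
          rw [ENNReal.mul_inv (Or.inl (by norm_num)) (Or.inl (by norm_num))]
          ring
      _ = M := by rw [ENNReal.inv_mul_cancel he0 he, mul_one, ← add_mul, h2, one_mul]
  obtain ⟨m, hm⟩ : ∃ m, f m ≤ 1 := by
    by_contra! h
    have : Nonempty (Fin M) := ⟨⟨0, Nat.pos_of_ne_zero hM⟩⟩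
    have hlt := ENNReal.sum_lt_sum_of_nonempty (s := Finset.univ) Finset.univ_nonempty
      (f := fun _ => (1 : ℝ≥0∞)) (g := f) fun m _ => h m
    rw [Finset.sum_const, Finset.card_univ, Fintype.card_fin, nsmul_eq_mul, mul_one] at hlt
    exact absurd hsum (not_le.2 hlt)
  refine ⟨m, {y | C.decode y = some m}, ?_, ?_⟩
  · have h := (le_add_right le_rfl).trans hm
    rw [mul_comm, ← div_eq_mul_inv, ENNReal.div_le_iff (by simpa using he0) (by finiteness),
      one_mul] at h
    exact h
  · have h := (le_add_left le_rfl).trans hm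
    calc q.toOuterMeasure {y | C.decode y = some m}
        = (2 * 2⁻¹) * ((M : ℝ≥0∞)⁻¹ * M) * q.toOuterMeasure {y | C.decode y = some m} := by
          rw [ENNReal.inv_mul_cancel hM0 hMt, ENNReal.mul_inv_cancel (by norm_num) (by norm_num),
            one_mul, one_mul]
      _ = 2 * (M : ℝ≥0∞)⁻¹ * (2⁻¹ * M * q.toOuterMeasure {y | C.decode y = some m}) := by ring
      _ ≤ 2 * (M : ℝ≥0∞)⁻¹ * 1 := by gcongr
      _ = _ := mul_one _

/-- The codeword's affinity with the zero input is less than `2 ^ (-(s * R' * cost))`. Both sides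
factor over the symbols, so one symbol satisfies the same strict inequality; the strictness leaves
room for `τ`. -/
lemma Achievable.exists_symbol {X Y : Type*} {W : X → PMF Y} {c : X → ℝ≥0} {R R' : ℝ≥0}
    (h : Achievable c (dmc W) R) (hR : R' < R) (x₀ : X) :
    ∃ (x : X) (s τ : ℝ), 0 < s ∧ s < 1 ∧ R' * c x < τ ∧
      (2 : ℝ≥0∞) ^ (s * τ) * affinity s (W x) (W x₀) < 1 := by
  have hR0 : (0 : ℝ) < R := lt_of_le_of_lt R'.coe_nonneg hR
  set r : ℝ := R' / R with hr
  have hr1 : r < 1 := (div_lt_one hR0).2 hR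
  have hr0 : 0 ≤ r := by positivity
  -- With `κ * (1 - r) = 2`, the bound `3 * 2 ^ (-κ)` on the affinity falls below `2 ^ (2 - κ) = 2 ^
  -- (-(κ * r))`.
  set κ : ℝ := 2 / (1 - r) with hκ
  have hκ0 : 0 < κ := div_pos (by norm_num) (by linarith)
  have hκr : κ * (1 - r) = 2 := div_mul_cancel₀ _ (by linarith)
  obtain ⟨M₀, hM₀⟩ := h (2 ^ (-(2 * κ) - 1)) (by positivity)
  obtain ⟨N, hN⟩ := exists_nat_gt ((2 : ℝ) ^ (2 * κ))
  obtain ⟨M, hMN, hMM₀⟩ : ∃ M, N ≤ M ∧ M₀ ≤ M := ⟨max M₀ N, le_max_right _ _, le_max_left _ _⟩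
  obtain ⟨T, P, ⟨C, hCP, hC⟩, hRP⟩ := hM₀ M hMM₀
  have hMκ : (2 : ℝ) ^ (2 * κ) < M := hN.trans_le (by exact_mod_cast hMN)
  have hMpos : (0 : ℝ) < M := lt_trans (by positivity) hMκ
  have hM : M ≠ 0 := by
    rintro rfl
    simp at hMpos
  have hlog : 2 * κ < Real.logb 2 M := (Real.lt_logb_iff_rpow_lt (by norm_num) hMpos).2 hMκ
  have hlog0 : 0 < Real.logb 2 M := by linarith
  -- This order turns the false alarm bound `2 / M` into `2 ^ (s - κ)`, while `s < 1 / 2` keeps the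
  -- missed detection term below `2 ^ (-κ)`.
  set s : ℝ := κ / Real.logb 2 M with hs
  have hs0 : 0 < s := by positivity
  have hslog : s * Real.logb 2 M = κ := div_mul_cancel₀ _ hlog0.ne'
  have hs1 : s < 1 / 2 := by
    rw [hs, div_lt_iff₀ hlog0]
    linarith
  have hεeq : ENNReal.ofReal (2 ^ (-(2 * κ) - 1)) = (2 : ℝ≥0∞) ^ (-(2 * κ) - 1) := by
    rw [← ENNReal.ofReal_rpow_of_pos (by norm_num), ENNReal.ofReal_ofNat]
  obtain ⟨m, A, hmiss, hfalse⟩ := C.exists_test hM (dmc W)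
    (indep (List.replicate T (W x₀))) (by simpa using by positivity) ENNReal.ofReal_ne_top hC
  have hmiss : (dmc W (C.word m)).toOuterMeasure Aᶜ ^ (1 - s) ≤ 2 ^ (-κ) := by
    calc _ ≤ ((2 : ℝ≥0∞) ^ (-(2 * κ))) ^ (1 - s) := by
          gcongr
          · linarith
          · refine hmiss.trans_eq ?_
            rw [hεeq]
            nth_rw 1 [← ENNReal.rpow_one 2]
            rw [← two_rpow_add]
            ring_nf
      _ = 2 ^ (-(2 * κ) * (1 - s)) := by rw [ENNReal.rpow_mul]
      _ ≤ _ := ENNReal.rpow_le_rpow_of_exponent_le (by norm_num) (by nlinarith)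
  have hfalse : (indep (List.replicate T (W x₀))).toOuterMeasure A ^ s ≤ 2 ^ (1 - κ) := by
    calc _ ≤ (2 * (M : ℝ≥0∞)⁻¹) ^ s := by gcongr
      _ = 2 ^ ((1 - Real.logb 2 M) * s) := by
          rw [← two_rpow_logb hM, ← ENNReal.rpow_neg, ENNReal.rpow_mul, sub_eq_add_neg,
            two_rpow_add, ENNReal.rpow_one]
      _ ≤ _ := ENNReal.rpow_le_rpow_of_exponent_le (by norm_num) (by nlinarith)
  have hub : affinity s (dmc W (C.word m)) (indep (List.replicate T (W x₀))) < 2 ^ (-(κ * r)) := by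
    refine (affinity_le hs0 (by linarith) _ _ A).trans_lt ?_
    calc _ ≤ (2 : ℝ≥0∞) ^ (-κ) + 2 ^ (1 - κ) := add_le_add hmiss hfalse
      _ = 2 ^ (-κ) * 3 := by
          rw [sub_eq_add_neg, two_rpow_add, ENNReal.rpow_one]
          ring
      _ < 2 ^ (-κ) * 4 := by
          rw [ENNReal.mul_lt_mul_iff_right]
          · norm_num
          · simp
          · simp
      _ = 2 ^ (-κ) * 2 ^ (2 : ℝ) := by norm_num
      _ = _ := by
          rw [← two_rpow_add]
          congr 1
          linarith
  have hlb : (2 : ℝ≥0∞) ^ (-(κ * r)) ≤ 2 ^ (-(s * R') * (seqCost c (C.word m) : ℝ)) := by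
    refine ENNReal.rpow_le_rpow_of_exponent_le (by norm_num) ?_
    have hcost : (seqCost c (C.word m) : ℝ) ≤ P := hCP m
    have : r * (R * P) ≤ r * Real.logb 2 M := by gcongr
    have hrR : r * R = R' := div_mul_cancel₀ _ hR0.ne'
    have h1 : s * (R' * seqCost c (C.word m)) ≤ s * (R' * P) := by gcongr
    have h2 : s * (r * (R * P)) ≤ s * (r * Real.logb 2 M) := by gcongr
    have h3 : s * (r * Real.logb 2 M) = κ * r := by rw [← hslog]; ring
    have h4 : s * (r * (R * P)) = s * (R' * P) := by rw [← hrR]; ring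
    linarith
  have hzero : List.replicate T (W x₀) = (C.word m).map fun _ => W x₀ := by
    rw [List.map_const', C.length_word]
  rw [hzero, dmc, affinity_indep hs0 (by linarith)] at hub
  obtain ⟨x, -, hx⟩ : ∃ x ∈ C.word m, affinity s (W x) (W x₀) < 2 ^ (-(s * R') * (c x : ℝ)) := by
    by_contra! hall
    exact absurd (hlb.trans (two_rpow_le_prod c _ _ _ hall)) (not_le.2 hub)
  -- A value strictly between the two sides; `τ` is defined by `2 ^ (-(s * τ)) = y`.
  obtain ⟨y, hy, hyx⟩ := ENNReal.lt_iff_exists_nnreal_btwn.1 hx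
  have hy0 : (0 : ℝ) < y := NNReal.coe_pos.2 (ENNReal.coe_pos.1 (pos_of_gt hy))
  have hy2 : (2 : ℝ≥0∞) ^ Real.logb 2 y = y := by
    rw [← ENNReal.ofReal_ofNat 2, ENNReal.ofReal_rpow_of_pos (by norm_num),
      Real.rpow_logb (by norm_num) (by norm_num) hy0, ENNReal.ofReal_coe_nnreal]
  refine ⟨x, s, -Real.logb 2 y / s, hs0, by linarith, ?_, ?_⟩
  · have hexp : Real.logb 2 y < -(s * R') * c x := by
      by_contra! hle
      exact absurd hyx (not_lt.2 (hy2 ▸ ENNReal.rpow_le_rpow_of_exponent_le (by norm_num) hle))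
    rw [lt_div_iff₀ hs0]
    linarith
  · rw [mul_div_cancel₀ _ hs0.ne', ENNReal.rpow_neg, hy2, mul_comm, ← div_eq_mul_inv]
    exact ENNReal.div_lt_of_lt_mul (by simpa using hy)

/-! ### Pulses through the insertion/deletion channel -/

section pulse

variable {X : Type*}

/-- `k` repetitions of `a` in a sequence of zeros. -/
def pulse (x₀ a : X) (t k r : ℕ) : List X :=
  List.replicate t x₀ ++ (List.replicate k a ++ List.replicate r x₀)

lemma length_pulse (x₀ a : X) (t k r : ℕ) : (pulse x₀ a t k r).length = t + (k + r) := by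
  simp [pulse]

lemma map_pulse {Y : Type*} (f : X → Y) (x₀ a : X) (t k r : ℕ) :
    (pulse x₀ a t k r).map f = pulse (f x₀) (f a) t k r := by
  simp [pulse]

lemma seqCost_pulse {c : X → ℝ≥0} {x₀ : X} (hx₀ : c x₀ = 0) (a : X) (t k r : ℕ) :
    seqCost c (pulse x₀ a t k r) = k * c a := by
  simp [pulse, seqCost_append, seqCost_replicate, hx₀]

lemma repeatSymbols_replicate_append (s : List ℕ) (t : ℕ) (a : X) (z : List X) :
    repeatSymbols s (List.replicate t a ++ z)
      = List.replicate (s.take t).sum a ++ repeatSymbols (s.drop t) z := by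
  induction t generalizing s with
  | zero => simp
  | succ t ih =>
    cases s with
    | nil => simp [repeatSymbols]
    | cons k s =>
      rw [List.replicate_succ, List.cons_append, repeatSymbols_cons, ih, List.take_succ_cons,
        List.drop_succ_cons, List.sum_cons, List.replicate_add, List.append_assoc]

/-- The insertion/deletion channel turns a pulse into a pulse: only its position, its length and the
trailing zeros change. -/
lemma repeatSymbols_pulse (s : List ℕ) (x₀ a : X) (t k r : ℕ) :
    ∃ r', repeatSymbols s (pulse x₀ a t k r)
      = pulse x₀ a (s.take t).sum ((s.drop t).take k).sum r' := by
  refine ⟨(((s.drop t).drop k).take r).sum, ?_⟩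
  rw [pulse, repeatSymbols_replicate_append, repeatSymbols_replicate_append, pulse,
    ← List.append_nil (List.replicate r x₀), repeatSymbols_replicate_append]
  simp [repeatSymbols]

lemma take_drop_pulse_of_le (x₀ a : X) {t k r n : ℕ} (hn : n ≤ k) :
    ((pulse x₀ a t k r).drop t).take n = List.replicate n a := by
  simp [pulse, List.take_append, hn]

/-- The end of the sequence may truncate the block, hence an unspecified `n'`. -/
lemma take_drop_pulse_of_disjoint (x₀ a : X) {t k r q n : ℕ} (h : q + n ≤ t ∨ t + k ≤ q) :
    ∃ n', ((pulse x₀ a t k r).drop q).take n = List.replicate n' x₀ := by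
  rcases h with h | h
  · refine ⟨n, ?_⟩
    have h1 : n ≤ t - q := by omega
    simp [pulse, List.take_append, List.drop_append, h1]
  · refine ⟨min n (r - (q - t - k)), ?_⟩
    have h1 : t - q = 0 := by omega
    have h2 : k - (q - t) = 0 := by omega
    simp [pulse, List.drop_append, h1, h2]

end pulse

/-! ### The likelihood ratio test -/

section test

variable {α : Type*}

/-- The likelihood ratio test between the product laws with factors `p` and `q`. -/
def likelihoodTest (θ : ℝ≥0∞) (p q : PMF α) : Set (List α) :=
  {z | θ * indep (List.replicate z.length q) z ≤ indep (List.replicate z.length p) z}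

/-- Change of measure on the acceptance set. The bound does not depend on `n`, so it also covers
truncated blocks. -/
lemma toOuterMeasure_likelihoodTest_le {θ : ℝ≥0∞} (hθ0 : θ ≠ 0) (hθ : θ ≠ ⊤) (p q : PMF α) (n : ℕ) :
    (indep (List.replicate n q)).toOuterMeasure (likelihoodTest θ p q) ≤ θ⁻¹ := by
  rw [← one_div, ENNReal.le_div_iff_mul_le (Or.inl hθ0) (Or.inl hθ), mul_comm,
    PMF.toOuterMeasure_apply, ← ENNReal.tsum_mul_left, ← (indep (List.replicate n p)).tsum_coe]
  refine ENNReal.tsum_le_tsum fun z => ?_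
  by_cases hz : z ∈ likelihoodTest θ p q
  · rw [Set.indicator_of_mem hz]
    by_cases h0 : indep (List.replicate n q) z = 0
    · simp [h0]
    · have hlen := length_eq_of_indep_ne_zero h0
      rw [List.length_replicate] at hlen
      subst hlen
      exact hz
  · simp [hz]

lemma toOuterMeasure_likelihoodTest_compl_le {s : ℝ} (hs0 : 0 < s) (hs1 : s < 1) (p q : PMF α)
    (τ : ℝ) (n : ℕ) :
    (indep (List.replicate n p)).toOuterMeasure (likelihoodTest (2 ^ (n * τ)) p q)ᶜ
      ≤ ((2 : ℝ≥0∞) ^ (s * τ) * affinity s p q) ^ n := by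
  have haff : affinity s (indep (List.replicate n p)) (indep (List.replicate n q))
      = affinity s p q ^ n := by
    have h := affinity_indep hs0 hs1 (fun _ : Unit => p) (fun _ => q) (List.replicate n ())
    simpa using h
  calc _ ≤ (indep (List.replicate n p)).toOuterMeasure
        {z | indep (List.replicate n p) z < 2 ^ (n * τ) * indep (List.replicate n q) z} := by
        refine PMF.toOuterMeasure_mono _ fun z hz => ?_
        have hlen := length_eq_of_indep_ne_zero ((PMF.mem_support_iff _ _).1 hz.2)
        rw [List.length_replicate] at hlen
        subst hlen
        have h := hz.1
        rw [likelihoodTest, Set.mem_compl_iff, Set.mem_ofPred_eq, not_le] at h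
        exact h
    _ ≤ _ := toOuterMeasure_lt_mul_le_affinity hs0.le hs1.le _ _ _
    _ = _ := by
        rw [haff, mul_pow, ← ENNReal.rpow_mul, ← ENNReal.rpow_natCast (2 ^ (s * τ)),
          ← ENNReal.rpow_mul]
        ring_nf

end test

/-! ### Decoding by scanning windows -/

section scan

variable {Y : Type*} {M : ℕ}

open Classical in
/-- Decode by a test on blocks of length `n`, where the message `m` passes if the test accepts a
block starting at a position in `I m`. -/
def scanDecode (I : Fin M → Finset ℕ) (n : ℕ) (A : Set (List Y)) (y : List Y) : Option (Fin M) :=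
  if h : ∃ m, ∃ q ∈ I m, (y.drop q).take n ∈ A then some h.choose else none

/-- If the true block at `p` passes and no block in another message's window does, any choice of a
passing message is correct. The decoder does not need to know `p`, only that it lies in `I m`. -/
lemma toOuterMeasure_scanDecode_ne_le (I : Fin M → Finset ℕ) (n : ℕ) (A : Set (List Y))
    (law : PMF (List Y)) {m : Fin M} {p : ℕ} (hp : p ∈ I m) {w : ℕ} (hw : ∀ m', (I m').card ≤ w)
    {α β : ℝ≥0∞} (hα : law.toOuterMeasure {y | (y.drop p).take n ∈ Aᶜ} ≤ α)
    (hβ : ∀ m' ≠ m, ∀ q ∈ I m', law.toOuterMeasure {y | (y.drop q).take n ∈ A} ≤ β) :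
    law.toOuterMeasure {y | scanDecode I n A y ≠ some m} ≤ α + M * (w * β) := by
  classical
  have hsub : {y | scanDecode I n A y ≠ some m} ⊆ {y | (y.drop p).take n ∈ Aᶜ} ∪
      ⋃ m' ∈ Finset.univ.erase m, ⋃ q ∈ I m', {y | (y.drop q).take n ∈ A} := by
    intro y hy
    by_contra hnot
    simp only [Set.mem_union, Set.mem_iUnion, Finset.mem_erase, Finset.mem_univ, and_true,
      Set.mem_ofPred_eq, Set.mem_compl_iff, not_or, not_not, not_exists] at hnot
    have hex : ∃ m, ∃ q ∈ I m, (y.drop q).take n ∈ A := ⟨m, p, hp, hnot.1⟩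
    refine hy ?_
    rw [scanDecode, dif_pos hex]
    by_contra hne
    obtain ⟨q, hq, hqA⟩ := hex.choose_spec
    exact hnot.2 _ (fun h => hne (by rw [h])) q hq hqA
  refine (MeasureTheory.measure_mono hsub).trans ((MeasureTheory.measure_union_le _ _).trans
    (add_le_add hα ?_))
  calc _ ≤ ∑ m' ∈ Finset.univ.erase m, ∑ q ∈ I m',
        law.toOuterMeasure {y | (y.drop q).take n ∈ A} :=
        (MeasureTheory.measure_biUnion_finset_le _ _).trans
          (Finset.sum_le_sum fun m' _ => MeasureTheory.measure_biUnion_finset_le _ _)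
    _ ≤ ∑ m' ∈ Finset.univ.erase m, ∑ q ∈ I m', β :=
        Finset.sum_le_sum fun m' hm' => Finset.sum_le_sum fun q hq =>
          hβ m' (Finset.ne_of_mem_erase hm') q hq
    _ ≤ ∑ m' ∈ Finset.univ.erase m, w * β := by
        refine Finset.sum_le_sum fun m' _ => ?_
        rw [Finset.sum_const, nsmul_eq_mul]
        gcongr
        exact hw m'
    _ ≤ ∑ _m' : Fin M, w * β := Finset.sum_le_sum_of_subset (Finset.erase_subset _ _)
    _ = _ := by simp

end scan

/-! ### The lower bound: pulse position modulation -/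

lemma HasMeanVariance.deviation_drop_take_le {S : PMF ℕ} {μ σsq : ℝ} (hS : HasMeanVariance S μ σsq)
    {T a b : ℕ} (hab : a + b ≤ T) {d : ℝ} (hd : 0 < d) :
    (indep (List.replicate T S)).toOuterMeasure {s | d ≤ |(((s.drop a).take b).sum : ℝ) - b * μ|}
      ≤ ENNReal.ofReal (b * σsq / d ^ 2) := by
  refine (toOuterMeasure_indep_drop_take (List.replicate T S) a b
    {s | d ≤ |(s.sum : ℝ) - b * μ|}).trans_le ?_
  have h : ((List.replicate T S).drop a).take b = List.replicate b S := by
    rw [List.drop_replicate, List.take_replicate, min_eq_left (by omega)]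
  rw [h]
  exact hS.deviation_le b hd

/-- The windows of naturals within `Δ` of the multiples of `step`. -/
def window (step Δ : ℝ) (m : ℕ) : Finset ℕ := Finset.Icc ⌈m * step - Δ⌉₊ ⌊m * step + Δ⌋₊

lemma mem_window {step Δ : ℝ} (hstep : 0 ≤ step) (hΔ : 0 ≤ Δ) {m q : ℕ} :
    q ∈ window step Δ m ↔ |(q : ℝ) - m * step| ≤ Δ := by
  rw [window, Finset.mem_Icc, Nat.ceil_le, Nat.le_floor_iff (by positivity), abs_le]
  constructor <;> rintro ⟨h1, h2⟩ <;> constructor <;> linarith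

lemma card_window_le {step Δ : ℝ} (hstep : 0 ≤ step) (hΔ : 0 ≤ Δ) (m : ℕ) :
    (window step Δ m).card ≤ ⌊2 * Δ + 1⌋₊ := by
  rw [window, Nat.card_Icc]
  refine Nat.le_floor ?_
  have h1 := Nat.le_ceil ((m : ℝ) * step - Δ)
  have h2 := Nat.floor_le (show 0 ≤ (m : ℝ) * step + Δ by positivity)
  rcases le_total ⌈(m : ℝ) * step - Δ⌉₊ (⌊(m : ℝ) * step + Δ⌋₊ + 1) with h | h
  · rw [Nat.cast_sub h]
    push_cast
    linarith
  · rw [Nat.sub_eq_zero_of_le h]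
    simpa using by positivity

/-- Pulse position modulation over the insertion/deletion channel followed by a memoryless
channel. -/
lemma existsCode_pulse {X Y : Type*} (W : X → PMF Y) {c : X → ℝ≥0} {x₀ : X} (hx₀ : c x₀ = 0)
    (x : X) {S : PMF ℕ} {μ σsq : ℝ} (hS : HasMeanVariance S μ σsq) {M B k n : ℕ} (hM : M ≠ 0)
    (hkB : k ≤ B) {Δ : ℝ} (hΔ : 0 < Δ) (hB : μ * k + 2 * Δ ≤ μ * B) (hn : n < μ * k) {s τ : ℝ}
    (hs0 : 0 < s) (hs1 : s < 1) {ε : ℝ}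
    (hε : ENNReal.ofReal (M * B * σsq / Δ ^ 2) + ENNReal.ofReal (M * B * σsq / Δ ^ 2)
      + ENNReal.ofReal (k * σsq / (μ * k - n) ^ 2)
      + (((2 : ℝ≥0∞) ^ (s * τ) * affinity s (W x) (W x₀)) ^ n
        + M * (⌊2 * Δ + 1⌋₊ * ((2 : ℝ≥0∞) ^ (n * τ))⁻¹)) ≤ ENNReal.ofReal ε) :
    ExistsCode c ((idc S).concat (dmc W)) (M * B) M (k * c x) ε := by
  have hμ := hS.mean_nonneg
  have hσ := hS.variance_nonneg
  have hend (m : Fin M) : m * B + k ≤ M * B := by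
    calc m * B + k ≤ m * B + B := by omega
      _ = (m + 1) * B := by ring
      _ ≤ M * B := Nat.mul_le_mul_right _ m.2
  have hθ0 : (2 : ℝ≥0∞) ^ (n * τ) ≠ 0 := by simp
  have hθ : (2 : ℝ≥0∞) ^ (n * τ) ≠ ⊤ := by simp
  have hμB : 0 ≤ μ * B := by positivity
  let I (m : Fin M) : Finset ℕ := window (μ * B) Δ m
  let A := likelihoodTest (2 ^ (n * τ)) (W x) (W x₀)
  refine ⟨⟨fun m => pulse x₀ x (m * B) k (M * B - (m * B + k)), fun m => ?_, scanDecode I n A⟩,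
    fun m => (seqCost_pulse hx₀ _ _ _ _).le, ?_⟩
  · have := hend m
    rw [length_pulse]
    omega
  rw [Code.errorProb_le_iff hM]
  calc _ ≤ ∑ _m : Fin M, ENNReal.ofReal ε := Finset.sum_le_sum fun m _ => ?_
    _ = _ := by simp [mul_comm]
  refine le_trans ?_ hε
  rw [toOuterMeasure_concat, expect_idc, length_pulse,
    show m * B + (k + (M * B - (m * B + k))) = M * B by have := hend m; omega]
  set α : ℝ≥0∞ := ((2 : ℝ≥0∞) ^ (s * τ) * affinity s (W x) (W x₀)) ^ n
        + M * (⌊2 * Δ + 1⌋₊ * ((2 : ℝ≥0∞) ^ (n * τ))⁻¹)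
  -- The atypical states: the received pulse starts too far from its mean position, ends too far
  -- from it, or may be shorter than the test block.
  let E₁ : Set (List ℕ) := {s | Δ ≤ |(((s.drop 0).take (m * B)).sum : ℝ) - (m * B : ℕ) * μ|}
  let E₂ : Set (List ℕ) := {s | Δ ≤ |(((s.drop 0).take (m * B + k)).sum : ℝ) - (m * B + k : ℕ) * μ|}
  let E₃ : Set (List ℕ) := {s | μ * k - n ≤ |(((s.drop (m * B)).take k).sum : ℝ) - k * μ|}
  calc _ ≤ expect (indep (List.replicate (M * B) S)) fun s =>
        E₁.indicator 1 s + E₂.indicator 1 s + E₃.indicator 1 s + α := by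
        refine expect_mono _ fun s => ?_
        by_cases h1 : s ∈ E₁
        · refine (toOuterMeasure_le_one _ _).trans ?_
          rw [Set.indicator_of_mem h1]
          exact le_add_right (le_add_right (le_add_right le_rfl))
        by_cases h2 : s ∈ E₂
        · refine (toOuterMeasure_le_one _ _).trans ?_
          rw [Set.indicator_of_mem h2]
          exact le_add_right (le_add_right (le_add_left le_rfl))
        by_cases h3 : s ∈ E₃
        · refine (toOuterMeasure_le_one _ _).trans ?_
          rw [Set.indicator_of_mem h3]
          exact le_add_right (le_add_left le_rfl)
        refine le_add_left ?_
        replace h1 : |((s.take (m * B)).sum : ℝ) - (m * B : ℕ) * μ| < Δ := not_le.1 h1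
        replace h2 : |((s.take (m * B + k)).sum : ℝ) - (m * B + k : ℕ) * μ| < Δ := not_le.1 h2
        replace h3 : |(((s.drop (m * B)).take k).sum : ℝ) - k * μ| < μ * k - n := not_le.1 h3
        obtain ⟨r, hr⟩ := repeatSymbols_pulse s x₀ x (m * B) k (M * B - (m * B + k))
        rw [List.take_add, List.sum_append] at h2
        simp only [hr]
        clear hr
        set p := (s.take (m * B)).sum
        set N := ((s.drop (m * B)).take k).sum
        push_cast at h1 h2
        rw [abs_lt] at h1 h2 h3
        have hlaw (q : ℕ) (A' : Set (List Y)) :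
            (dmc W (pulse x₀ x p N r)).toOuterMeasure {y | (y.drop q).take n ∈ A'}
              = (indep (((pulse (W x₀) (W x) p N r).drop q).take n)).toOuterMeasure A' := by
          rw [dmc, map_pulse, toOuterMeasure_indep_drop_take]
        refine toOuterMeasure_scanDecode_ne_le I n A _ (p := p) ?_
          (fun m' => card_window_le hμB hΔ.le m') ?_ fun m' hm' q hq => ?_
        · rw [mem_window hμB hΔ.le, abs_le]
          constructor <;> linarith
        · rw [hlaw, take_drop_pulse_of_le _ _ (by
            have : (n : ℝ) < N := by linarith
            exact_mod_cast this.le)]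
          exact toOuterMeasure_likelihoodTest_compl_le hs0 hs1 _ _ _ _
        · rw [mem_window hμB hΔ.le, abs_le] at hq
          -- By `hB`, neighbouring windows are at least `μ * k` apart beyond the drift `Δ` of the
          -- pulse. A block from an earlier window ends before the pulse since `n < μ * k`; one from
          -- a later window starts after it.
          have hdisj : q + n ≤ p ∨ p + N ≤ q := by
            rcases lt_or_gt_of_ne hm' with hlt | hgt
            · left
              have h4 : ((m' : ℕ) : ℝ) + 1 ≤ (m : ℕ) := by exact_mod_cast hlt
              have h5 : (((m' : ℕ) : ℝ) + 1) * (μ * B) ≤ (m : ℕ) * (μ * B) := by gcongr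
              have : (q : ℝ) + n ≤ p := by linarith
              exact_mod_cast this
            · right
              have h4 : ((m : ℕ) : ℝ) + 1 ≤ (m' : ℕ) := by exact_mod_cast hgt
              have h5 : (((m : ℕ) : ℝ) + 1) * (μ * B) ≤ (m' : ℕ) * (μ * B) := by gcongr
              have : (p : ℝ) + N ≤ q := by linarith
              exact_mod_cast this
          obtain ⟨n', hn'⟩ := take_drop_pulse_of_disjoint (r := r) (W x₀) (W x) hdisj
          rw [hlaw, hn']
          exact toOuterMeasure_likelihoodTest_le hθ0 hθ _ _ _
    _ ≤ _ := by
        have hmB : ((m * B : ℕ) : ℝ) ≤ M * B := by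
          exact_mod_cast (Nat.le_add_right _ _).trans (hend m)
        have hmBk : ((m * B + k : ℕ) : ℝ) ≤ M * B := by exact_mod_cast hend m
        rw [expect_add, expect_add, expect_add, expect_const, ← toOuterMeasure_eq_expect,
          ← toOuterMeasure_eq_expect, ← toOuterMeasure_eq_expect]
        gcongr
        · refine (hS.deviation_drop_take_le (by have := hend m; omega) hΔ).trans ?_
          gcongr
        · refine (hS.deviation_drop_take_le (by have := hend m; omega) hΔ).trans ?_
          gcongr
        · exact hS.deviation_drop_take_le (hend m) (by linarith)

open Filter in
lemma eventually_mul_add_one_le_two_rpow (α : ℝ) :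
    ∀ᶠ L : ℝ in atTop, α * L + 1 ≤ (2 : ℝ) ^ L := by
  have hlog : 0 < Real.log 2 := Real.log_pos (by norm_num)
  filter_upwards [eventually_ge_atTop (0 : ℝ), eventually_ge_atTop (2 * α / Real.log 2 ^ 2)]
    with L hL0 hL
  rw [div_le_iff₀ (by positivity)] at hL
  rw [Real.rpow_def_of_pos (by norm_num)]
  have h0 : 0 ≤ Real.log 2 * L := by positivity
  have := Real.quadratic_le_exp_of_nonneg h0
  nlinarith

/-- The union bound has order `M² = 2 ^ (2 * L)` terms, each of order `2 ^ (-(β * τ * L))`, where `L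
= log M`; hence the condition `β * τ > 2`. -/
lemma mul_card_mul_inv_two_rpow_le {M n : ℕ} (hM : 1 ≤ M) {D τ β e : ℝ} (hD : 0 ≤ D) (hτ : 0 ≤ τ)
    (he : 0 < e) (hη : 0 < β * τ - 2) (hn : β * Real.logb 2 M - 1 ≤ n)
    (hL : Real.logb 2 ((2 * D + 1) * 2 ^ τ / e) / (β * τ - 2) ≤ Real.logb 2 M) :
    (M : ℝ≥0∞) * (⌊2 * (D * M) + 1⌋₊ * ((2 : ℝ≥0∞) ^ (n * τ))⁻¹) ≤ ENNReal.ofReal e := by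
  have hMge : (1 : ℝ) ≤ M := by exact_mod_cast hM
  have hrpow : (2 : ℝ) ^ Real.logb 2 M = M :=
    Real.rpow_logb (by norm_num) (by norm_num) (by positivity)
  set L := Real.logb 2 M
  rw [div_le_iff₀ hη, Real.logb_le_iff_le_rpow (by norm_num) (by positivity),
    div_le_iff₀ he] at hL
  have hexp : (2 : ℝ) ^ (-(n * τ)) ≤ 2 ^ τ * 2 ^ (-(β * L * τ)) := by
    rw [← Real.rpow_add (by norm_num)]
    refine Real.rpow_le_rpow_of_exponent_le (by norm_num) ?_
    have := mul_le_mul_of_nonneg_right hn hτ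
    linarith
  have hM2 : (M : ℝ) * (2 * (D * M) + 1) ≤ (2 * D + 1) * 2 ^ (2 * L) := by
    rw [mul_comm 2 L, Real.rpow_mul (by norm_num), hrpow, Real.rpow_two]
    have : (M : ℝ) * 1 ≤ M * M := by gcongr
    linarith
  have hreal : (M : ℝ) * ((2 * (D * M) + 1) * (2 : ℝ) ^ (-(n * τ))) ≤ e := by
    calc (M : ℝ) * ((2 * (D * M) + 1) * (2 : ℝ) ^ (-(n * τ)))
        = (M * (2 * (D * M) + 1)) * (2 : ℝ) ^ (-(n * τ)) := by ring
      _ ≤ ((2 * D + 1) * 2 ^ (2 * L)) * (2 ^ τ * 2 ^ (-(β * L * τ))) := by gcongr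
      _ = (2 * D + 1) * 2 ^ τ * 2 ^ (2 * L + -(β * L * τ)) := by
          rw [Real.rpow_add (by norm_num)]
          ring
      _ ≤ (2 ^ (L * (β * τ - 2)) * e) * 2 ^ (2 * L + -(β * L * τ)) := by gcongr
      _ = 2 ^ (L * (β * τ - 2) + (2 * L + -(β * L * τ))) * e := by
          rw [Real.rpow_add (by norm_num) (L * (β * τ - 2))]
          ring
      _ = e := by
          rw [show L * (β * τ - 2) + (2 * L + -(β * L * τ)) = 0 by ring, Real.rpow_zero, one_mul]
  have h2 : ((2 : ℝ≥0∞) ^ (n * τ))⁻¹ = ENNReal.ofReal ((2 : ℝ) ^ (-(n * τ))) := by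
    rw [← ENNReal.ofReal_rpow_of_pos (by norm_num), ENNReal.ofReal_ofNat, ENNReal.rpow_neg]
  rw [h2, ← ENNReal.ofReal_natCast, ← ENNReal.ofReal_natCast,
    ← ENNReal.ofReal_mul (by positivity), ← ENNReal.ofReal_mul (by positivity)]
  refine ENNReal.ofReal_le_ofReal (le_trans ?_ hreal)
  gcongr
  exact Nat.floor_le (by positivity)

open Filter in
/-- A symbol that can be tested against the zero symbol with error exponent `τ` serves as the pulse
of a code for the channel with insertions and deletions. -/
lemma achievable_idc_concat_of_affinity {X Y : Type*} (W : X → PMF Y) {c : X → ℝ≥0} {x₀ : X}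
    (hx₀ : c x₀ = 0) (x : X) {S : PMF ℕ} {μ σsq : ℝ} (hS : HasMeanVariance S μ σsq) (hμ : 0 < μ)
    {s τ : ℝ} (hs0 : 0 < s) (hs1 : s < 1)
    (haff : (2 : ℝ≥0∞) ^ (s * τ) * affinity s (W x) (W x₀) < 1) {R : ℝ≥0}
    (hR : 2 * (R * c x) < μ * τ) : Achievable c ((idc S).concat (dmc W)) R := by
  intro ε hε
  have hσ := hS.variance_nonneg
  set b : ℝ := R * c x with hb
  have hb0 : 0 ≤ b := by positivity
  have hτ : 0 < τ := pos_of_mul_pos_right (lt_of_le_of_lt (by positivity) hR) hμ.le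
  have hden : 0 < μ * τ + 2 * b := by positivity
  -- Pulses have length about `α * log M`. The rate requires `b * α < 1` and the test `α * μ * τ >
  -- 2`; `1 / α` is the midpoint of `b` and `μ * τ / 2`.
  set α : ℝ := 4 / (μ * τ + 2 * b) with hα
  have hα0 : 0 < α := by positivity
  have hαb : b * α < 1 := by
    rw [hα, mul_div_assoc', div_lt_one hden]
    linarith
  have hατ : 2 < α * μ * τ := by
    rw [hα, div_mul_eq_mul_div, div_mul_eq_mul_div, lt_div_iff₀ hden]
    linarith
  -- The test block of length about `β * log M` is long enough for the union bound, yet shorter than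
  -- the mean received pulse.
  obtain ⟨β, hβτ, hβα⟩ : ∃ β, 2 / τ < β ∧ β < α * μ :=
    exists_between ((div_lt_iff₀ hτ).2 hατ)
  have hβ0 : 0 < β := lt_trans (by positivity) hβτ
  rw [div_lt_iff₀ hτ] at hβτ
  set γ : ℝ := α * μ - β with hγ
  have hγ0 : 0 < γ := sub_pos.2 hβα
  -- With drift allowance `D * M` and slots of length `D' * M`, Chebyshev gives `σsq * D' / D²`,
  -- which is at most `ε / 5` for this `D` because `D'` is at most linear in `D`.
  obtain ⟨D, hD⟩ := exists_nat_ge (max 1 (σsq * (2 / μ + 2) / (ε / 5)))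
  have hD1 : (1 : ℝ) ≤ D := (le_max_left _ _).trans hD
  have hDε : σsq * (2 / μ + 2) ≤ D * (ε / 5) :=
    (div_le_iff₀ (by positivity)).1 ((le_max_right _ _).trans hD)
  set D' : ℕ := ⌈2 * D / μ⌉₊ + 1 with hD'
  have hD'1 : 1 ≤ D' := by omega
  have hD'lb : 2 * D + μ ≤ μ * D' := by
    have := Nat.le_ceil (2 * (D : ℝ) / μ)
    rw [div_le_iff₀ hμ] at this
    rw [hD']
    push_cast
    linarith
  have hD'ub : (D' : ℝ) ≤ D * (2 / μ + 2) := by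
    have := Nat.ceil_lt_add_one (show 0 ≤ 2 * (D : ℝ) / μ by positivity)
    rw [hD']
    push_cast
    have h2 : 2 * (D : ℝ) / μ = D * (2 / μ) := by ring
    linarith
  have hη : 0 < β * τ - 2 := by linarith
  have hlogb : Tendsto (fun M : ℕ => Real.logb 2 M) atTop atTop :=
    (Real.tendsto_logb_atTop (by norm_num)).comp tendsto_natCast_atTop_atTop
  have hfloor : Tendsto (fun M : ℕ => ⌊β * Real.logb 2 M⌋₊) atTop atTop :=
    tendsto_nat_floor_atTop.comp (hlogb.const_mul_atTop hβ0)
  have hpow := (ENNReal.tendsto_pow_atTop_nhds_zero_of_lt_one haff).comp hfloor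
  have hε5 : (0 : ℝ≥0∞) < ENNReal.ofReal (ε / 5) := ENNReal.ofReal_pos.2 (by positivity)
  have hev : ∀ᶠ M : ℕ in atTop, ∃ (T : ℕ) (P : ℝ≥0),
      ExistsCode c ((idc S).concat (dmc W)) T M P ε ∧ (R : ℝ) * P ≤ Real.logb 2 M := by
    filter_upwards [eventually_ge_atTop 1, hpow.eventually (gt_mem_nhds hε5),
      hlogb.eventually (eventually_ge_atTop 1),
      -- Ensures `k ≤ M`, so the pulse fits into its slot.
      hlogb.eventually (eventually_mul_add_one_le_two_rpow α),
      hlogb.eventually (eventually_ge_atTop (b / (1 - b * α))),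
      hlogb.eventually (eventually_ge_atTop ((α + 1) * σsq / (γ ^ 2 * (ε / 5)))),
      hlogb.eventually (eventually_ge_atTop (Real.logb 2 ((2 * D + 1) * 2 ^ τ / (ε / 5)) / (β * τ - 2)))]
      with M hM1 hmiss hL1 hLM hLb hLσ hLC
    have hMpos : (0 : ℝ) < M := by positivity
    have hrpow : (2 : ℝ) ^ Real.logb 2 M = M := Real.rpow_logb (by norm_num) (by norm_num) hMpos
    have hMge : (1 : ℝ) ≤ M := by exact_mod_cast hM1
    rw [hrpow] at hLM
    set L := Real.logb 2 M
    have hL0 : 0 < L := by linarith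
    set k : ℕ := ⌈α * L⌉₊
    set n : ℕ := ⌊β * L⌋₊
    have hkl : α * L ≤ k := Nat.le_ceil _
    have hku : (k : ℝ) ≤ α * L + 1 := (Nat.ceil_lt_add_one (by positivity)).le
    have hnu : (n : ℝ) ≤ β * L := Nat.floor_le (by positivity)
    have hnl : β * L - 1 ≤ n := (Nat.sub_one_lt_floor _).le
    have hkM : (k : ℝ) ≤ M := hku.trans hLM
    have hkn : γ * L ≤ μ * k - n := by
      have : μ * (α * L) ≤ μ * k := by gcongr
      rw [hγ]
      linarith
    have hγL : 0 < γ * L := by positivity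
    refine ⟨M * (D' * M), k * c x, existsCode_pulse W hx₀ x hS (B := D' * M) (k := k) (n := n)
      (Δ := D * M) (by omega) ?_ (by positivity) ?_ (by linarith) hs0 hs1 (τ := τ) ?_, ?_⟩
    · have : k ≤ M := by exact_mod_cast hkM
      exact this.trans (Nat.le_mul_of_pos_left _ hD'1)
    · push_cast
      have h1 : μ * k ≤ μ * M := by gcongr
      have h2 : (2 * D + μ) * M ≤ μ * D' * M := by gcongr
      linarith
    · have h1 : M * ((D' * M : ℕ) : ℝ) * σsq / (D * M) ^ 2 ≤ ε / 5 := by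
        rw [div_le_iff₀ (by positivity)]
        push_cast
        calc (M : ℝ) * (D' * M) * σsq = D' * σsq * M ^ 2 := by ring
          _ ≤ D * (2 / μ + 2) * σsq * M ^ 2 := by gcongr
          _ = D * (σsq * (2 / μ + 2)) * M ^ 2 := by ring
          _ ≤ D * (D * (ε / 5)) * M ^ 2 := by gcongr
          _ = _ := by ring
      have h2 : k * σsq / (μ * k - n) ^ 2 ≤ ε / 5 := by
        rw [div_le_iff₀ (by positivity)] at hLσ
        calc k * σsq / (μ * k - n) ^ 2 ≤ ((α + 1) * L) * σsq / (γ * L) ^ 2 := by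
              gcongr
              linarith
          _ ≤ ε / 5 := by
              rw [div_le_iff₀ (by positivity)]
              calc (α + 1) * L * σsq = ((α + 1) * σsq) * L := by ring
                _ ≤ (L * (γ ^ 2 * (ε / 5))) * L := by gcongr
                _ = _ := by ring
      have h3 : (M : ℝ≥0∞) * (⌊2 * ((D : ℝ) * M) + 1⌋₊ * ((2 : ℝ≥0∞) ^ (n * τ))⁻¹)
          ≤ ENNReal.ofReal (ε / 5) :=
        mul_card_mul_inv_two_rpow_le hM1 (by positivity) hτ.le (by positivity) hη hnl hLC
      calc _ ≤ ENNReal.ofReal (ε / 5) + ENNReal.ofReal (ε / 5) + ENNReal.ofReal (ε / 5)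
            + (ENNReal.ofReal (ε / 5) + ENNReal.ofReal (ε / 5)) := by
            gcongr
            exact hmiss.le
        _ = ENNReal.ofReal ε := by
            simp only [← ENNReal.ofReal_add (show 0 ≤ ε / 5 by positivity)
              (show 0 ≤ ε / 5 by positivity)]
            rw [← ENNReal.ofReal_add (by positivity) (by positivity),
              ← ENNReal.ofReal_add (by positivity) (by positivity)]
            congr 1
            ring
    · rw [div_le_iff₀ (by linarith)] at hLb
      calc (R : ℝ) * ((k * c x : ℝ≥0) : ℝ) = b * k := by
            push_cast
            rw [hb]
            ring
        _ ≤ b * (α * L + 1) := by gcongr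
        _ ≤ L := by linarith
  exact eventually_atTop.1 hev

lemma le_capacityPerUnitCost_idc_concat {X Y : Type*} (W : X → PMF Y) (c : X → ℝ≥0) {x₀ : X}
    (hx₀ : c x₀ = 0) {S : PMF ℕ} {μ σsq : ℝ} (hS : HasMeanVariance S μ σsq) :
    ENNReal.ofReal (μ / 2) * capacityPerUnitCost c (dmc W)
      ≤ capacityPerUnitCost c ((idc S).concat (dmc W)) := by
  rcases hS.mean_nonneg.eq_or_lt with rfl | hμ
  · simp
  have hμ2 : 0 < μ / 2 := by positivity
  have hμ0 : ENNReal.ofReal (μ / 2) ≠ 0 := by simpa using hμ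
  rw [mul_comm, ← ENNReal.le_div_iff_mul_le (Or.inl hμ0) (Or.inl ENNReal.ofReal_ne_top)]
  refine iSup₂_le fun R hR => ENNReal.le_of_forall_nnreal_lt fun R' hR' => ?_
  obtain ⟨x, s, τ, hs0, hs1, hτ, haff⟩ := hR.exists_symbol (ENNReal.coe_lt_coe.1 hR') x₀
  rw [ENNReal.le_div_iff_mul_le (Or.inl hμ0) (Or.inl ENNReal.ofReal_ne_top)]
  refine le_iSup₂_of_le (R' * (μ / 2).toNNReal)
    (achievable_idc_concat_of_affinity W hx₀ x hS hμ hs0 hs1 haff ?_) ?_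
  · rw [NNReal.coe_mul, Real.coe_toNNReal _ hμ2.le]
    calc 2 * ((R' : ℝ) * (μ / 2) * c x) = μ * (R' * c x) := by ring
      _ < μ * τ := by gcongr
  · rw [ENNReal.coe_mul]
    rfl

end

end InsDel

theorem corollary1 {X Y : Type*} (W : X → PMF Y) (c : X → ℝ≥0) (x₀ : X) (hx₀ : c x₀ = 0)
    (S : PMF ℕ) (μ σsq : ℝ) (hS : InsDel.HasMeanVariance S μ σsq) :
    ENNReal.ofReal (μ / 2) * InsDel.capacityPerUnitCost c (InsDel.dmc W)
        ≤ InsDel.capacityPerUnitCost c ((InsDel.idc S).concat (InsDel.dmc W)) ∧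
      InsDel.capacityPerUnitCost c ((InsDel.idc S).concat (InsDel.dmc W))
        ≤ ENNReal.ofReal μ * InsDel.capacityPerUnitCost c (InsDel.dmc W) :=
  ⟨InsDel.le_capacityPerUnitCost_idc_concat W c hx₀ hS,
    InsDel.capacityPerUnitCost_idc_concat_le W c hS⟩
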